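/- **Theorem 4.4.** Multigraphs are finite and may have loops and parallel edges. The automorphism group $\operatorname{Aut} G$ acts on vertices and half-edges, so it includes permutations of parallel edges and permutations and flips of loops; for rooted trees, automorphisms fix the root. For a multigraph $G$ and a coloring $c\colon V(G)\to\mathbb Z/2$ ($1$ = black, $0$ = white), let $B(c)$ be the set of black vertices, and let $W_+(c)$ (resp. $W_-(c)$) be the set of white vertices with an even (resp. odd) number of black neighbours, counted with the multiplicity of edges. Put $$\widetilde W_G(b,w_-,w_+)=\sum_{c} b^{|B(c)|}\,w_+^{|W_+(c)|}\,w_-^{|W_-(c)|},\qquad W_G(t)=\sum_c t^{|W_+(c)|}.$$ Let $$\mathcal W_1(x)=\sum_{G}\frac{W_G(t)\,x^{|V(G)|}}{|\operatorname{Aut} G|}\in\mathbb Q[t][[x]],$$ the sum being over isomorphism classes of connected multigraphs $G$ with first Betti number $1$. Let $\mathcal T_b,\mathcal T_w^+,\mathcal T_w^-\in\mathbb Q[t][[x]]$ be the series $$\sum_{T}\frac{x^{|V(T)|}}{|\operatorname{Aut} T|}\sum_{c} t^{|W_+(c)|},$$ where $T$ runs over isomorphism classes of rooted trees and $c$ over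 those colorings of $T$ in which the root lies in $B(c)$, $W_+(c)$, $W_-(c)$, respectively. For $n\ge1$ let $C_n$ be the $n$-cycle ($C_1$ is a vertex with a loop, $C_2$ is two vertices joined by two parallel edges), and let $$\mathcal Z=\sum_{n\ge1}\frac{\widetilde W_{C_n}(b,w_-,w_+)}{|\operatorname{Aut} C_n|}\in\mathbb Q[[b,w_-,w_+]].$$ Then all these series are well defined (every coefficient is a finite sum), the substitution $$b\leftarrow\mathcal T_b,\qquad w_+\leftarrow\mathcal T_w^++\mathcal T_w^-,\qquad w_-\leftarrow t^{-1}\mathcal T_w^++t\,\mathcal T_w^-$$ into $\mathcal Z$ is well defined in $\mathbb Q[t,t^{-1}][[x]]$, and its result is $\mathcal W_1(x)$. -/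

import Mathlib

open scoped Polynomial LaurentPolynomial

namespace BlackWhite

/-- A multigraph (loops and parallel edges allowed) with vertex set `V` and set of half-edges `H`.
Each half-edge is attached to a vertex, and a fixed-point-free involution pairs the half-edges
into edges; a loop is an edge both of whose half-edges are attached to the same vertex. -/
structure Multigraph (V H : Type*) where
  vert : H → V
  opp : H → H
  opp_opp : ∀ h, opp (opp h) = h
  opp_ne : ∀ h, opp h ≠ h

namespace Multigraph

/-- Isomorphisms of multigraphs: compatible bijections of vertices and of half-edges. -/
structure Iso {V H V' H' : Type*} (G : Multigraph V H) (G' : Multigraph V' H') where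
  onVert : V ≃ V'
  onHalf : H ≃ H'
  vert_comm : ∀ h, G'.vert (onHalf h) = onVert (G.vert h)
  opp_comm : ∀ h, G'.opp (onHalf h) = onHalf (G.opp h)

namespace Iso

def refl {V H : Type*} (G : Multigraph V H) : Iso G G :=
  ⟨Equiv.refl V, Equiv.refl H, fun _ => rfl, fun _ => rfl⟩

def symm {V H V' H' : Type*} {G : Multigraph V H} {G' : Multigraph V' H'}
    (e : Iso G G') : Iso G' G where
  onVert := e.onVert.symm
  onHalf := e.onHalf.symm
  vert_comm h := by
    rw [Equiv.eq_symm_apply, ← e.vert_comm, Equiv.apply_symm_apply]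
  opp_comm h := by
    rw [Equiv.eq_symm_apply, ← e.opp_comm, Equiv.apply_symm_apply]

def trans {V H V' H' V'' H'' : Type*} {G : Multigraph V H} {G' : Multigraph V' H'}
    {G'' : Multigraph V'' H''} (e : Iso G G') (f : Iso G' G'') : Iso G G'' where
  onVert := e.onVert.trans f.onVert
  onHalf := e.onHalf.trans f.onHalf
  vert_comm h := by simp [f.vert_comm, e.vert_comm]
  opp_comm h := by simp [f.opp_comm, e.opp_comm]

end Iso

/-- The order of the full automorphism group. It includes the automorphisms that permute parallel
edges, permute loops or flip loops. -/
noncomputable def autCard {V H : Type*} (G : Multigraph V H) : ℕ := Nat.card (Iso G G)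

/-- Connected multigraphs; the empty graph is not connected. -/
def Connected {V H : Type*} (G : Multigraph V H) : Prop :=
  Nonempty V ∧
    ∀ u v : V, Relation.ReflTransGen (fun a b => ∃ h, G.vert h = a ∧ G.vert (G.opp h) = b) u v

/-- Integral 1-chains: `f h` is the coefficient of the edge of `h`, oriented from `vert h`
to `vert (opp h)`, so that reversing the orientation changes the sign. -/
def oneChains {V H : Type*} (G : Multigraph V H) : Submodule ℤ (H → ℤ) where
  carrier := {f | ∀ h, f (G.opp h) = - f h}
  zero_mem' := by intro h; simp
  add_mem' := by intro f g hf hg h; simp only [Pi.add_apply, hf h, hg h]; ring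
  smul_mem' := by intro a f hf h; simp only [Pi.smul_apply, smul_eq_mul, hf h]; ring

/-- The boundary map from 1-chains to 0-chains. The coefficient at `v` is the sum of `f h` over the
oriented edges `h` that end at `v`; by antisymmetry this accounts for the starting points too. -/
def boundary {V H : Type*} [DecidableEq V] [Fintype H] (G : Multigraph V H) :
    G.oneChains →ₗ[ℤ] (V → ℤ) where
  toFun f := fun v => ∑ h : H with G.vert (G.opp h) = v, f.1 h
  map_add' f g := by
    funext v
    simp [Finset.sum_add_distrib]
  map_smul' a f := by
    funext v
    simp [Finset.mul_sum]

/-- The loop number: the first Betti number, i.e. the rank of `H₁(G; ℤ) = ker ∂`. -/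
noncomputable def loopNumber {V H : Type*} [DecidableEq V] [Fintype H] (G : Multigraph V H) : ℕ :=
  Module.finrank ℤ (LinearMap.ker G.boundary)

/-- The number of black (`= 1`) neighbours of `v` in the coloring `c`, counted with the
multiplicities of parallel edges. (At a white vertex, loops contribute nothing.) -/
def blackNbrs {V H : Type*} [DecidableEq V] [Fintype H] (G : Multigraph V H)
    (c : V → ZMod 2) (v : V) : ℕ :=
  (Finset.univ.filter fun h : H => G.vert h = v ∧ c (G.vert (G.opp h)) = 1).card

/-- The set `α(c)` of the vertices that contribute a factor `t`: the white (`= 0`) vertices with an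
even number of black neighbours. All other vertices contribute a factor `1`. -/
def admissible {V H : Type*} [Fintype V] [DecidableEq V] [Fintype H] (G : Multigraph V H)
    (c : V → ZMod 2) : Finset V :=
  Finset.univ.filter fun v => c v = 0 ∧ Even (G.blackNbrs c v)

/-- The black-white polynomial `W_G(t) = ∑_c ∏_{v ∈ α(c)} t`; for a single vertex it is `t + 1`, for
the path with two vertices it is `t² + 3`. -/
noncomputable def W {V H : Type*} [Fintype V] [DecidableEq V] [Fintype H]
    (G : Multigraph V H) : ℤ[X] :=
  ∑ c : V → ZMod 2, ∏ _v ∈ G.admissible c, Polynomial.X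

end Multigraph

/-- The three kinds of vertices of a colored graph, which also index the variables
`b`, `w₊`, `w₋` and the three series of rooted trees. -/
inductive Kind where
  | b
  | wPlus
  | wMinus
  deriving DecidableEq

namespace Multigraph

/-- `b` for a black vertex, `w₊` (resp. `w₋`) for a white vertex with an even (resp. odd) number
of black neighbours. -/
def kind {V H : Type*} [DecidableEq V] [Fintype H] (G : Multigraph V H)
    (c : V → ZMod 2) (v : V) : Kind :=
  if c v = 1 then Kind.b else if Even (G.blackNbrs c v) then Kind.wPlus else Kind.wMinus

/-- The full `W`-polynomial in the variables `b`, `w₊`, `w₋`. -/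
noncomputable def fullW {V H : Type*} [Fintype V] [DecidableEq V] [Fintype H]
    (G : Multigraph V H) : MvPolynomial Kind ℤ :=
  ∑ c : V → ZMod 2, ∏ v : V, MvPolynomial.X (G.kind c v)

/-- The cycle `C_n`: the `i`-th edge joins the vertex `i` to its cyclic successor. `C_1` is a vertex
with a loop, and `C_2` consists of two vertices joined by two parallel edges. -/
def cycle (n : ℕ) : Multigraph (Fin n) (Fin n × Bool) where
  vert h := if h.2 then finRotate n h.1 else h.1
  opp h := (h.1, !h.2)
  opp_opp h := by simp
  opp_ne h := by simp [Prod.ext_iff]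

end Multigraph

/-- Connected multigraphs of loop number `g` on the vertex set `{0, …, n - 1}`. Every finite
connected multigraph of loop number `g` with `n` vertices is isomorphic to one of these. -/
structure LoopGraph (g n : ℕ) where
  numHalf : ℕ
  graph : Multigraph (Fin n) (Fin numHalf)
  connected : graph.Connected
  loopNumber_eq : graph.loopNumber = g

instance LoopGraph.isoSetoid (g n : ℕ) : Setoid (LoopGraph g n) where
  r A B := Nonempty (Multigraph.Iso A.graph B.graph)
  iseqv := ⟨fun A => ⟨.refl A.graph⟩, fun ⟨e⟩ => ⟨e.symm⟩, fun ⟨e⟩ ⟨f⟩ => ⟨e.trans f⟩⟩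

/-- The elements of `Γ(g)` with `n` vertices: isomorphism classes of connected multigraphs of
loop number `g` with `n` vertices. -/
def LoopClass (g n : ℕ) : Type := Quotient (LoopGraph.isoSetoid g n)

/-- The series `𝒲_g(x) = ∑_{G ∈ Γ(g)} W_G(t) x^{v(G)} / |Aut G|` in `ℚ[t]⟦x⟧`. -/
noncomputable def loopSeries (g : ℕ) : PowerSeries ℚ[X] :=
  PowerSeries.mk fun n => ∑ᶠ q : LoopClass g n,
    Polynomial.C ((q.out.graph.autCard : ℚ)⁻¹) * q.out.graph.W.map (Int.castRingHom ℚ)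

/-- Rooted trees (connected, of loop number `0`, with a distinguished vertex) on the vertex set
`{0, …, n - 1}`. -/
structure RootedTree (n : ℕ) where
  numHalf : ℕ
  graph : Multigraph (Fin n) (Fin numHalf)
  connected : graph.Connected
  loopNumber_eq : graph.loopNumber = 0
  root : Fin n

namespace RootedTree

/-- Isomorphisms of rooted trees preserve the root. -/
def Iso {n : ℕ} (A B : RootedTree n) : Type :=
  {e : Multigraph.Iso A.graph B.graph // e.onVert A.root = B.root}

/-- The order of the group of root-preserving automorphisms. -/
noncomputable def autCard {n : ℕ} (A : RootedTree n) : ℕ := Nat.card (Iso A A)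

instance isoSetoid (n : ℕ) : Setoid (RootedTree n) where
  r A B := Nonempty (Iso A B)
  iseqv := by
    refine ⟨fun A => ⟨⟨.refl A.graph, rfl⟩⟩, ?_, ?_⟩
    · rintro A B ⟨e, he⟩
      exact ⟨⟨e.symm, by simp [Multigraph.Iso.symm, ← he]⟩⟩
    · rintro A B C ⟨e, he⟩ ⟨f, hf⟩
      exact ⟨⟨e.trans f, by simp [Multigraph.Iso.trans, he, hf]⟩⟩

/-- The part of `W_T(t)` that comes from the colorings in which the root is of kind `s`. -/
noncomputable def partW {n : ℕ} (A : RootedTree n) (s : Kind) : ℤ[X] :=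
  ∑ c : Fin n → ZMod 2 with A.graph.kind c A.root = s,
    ∏ _v ∈ A.graph.admissible c, Polynomial.X

end RootedTree

/-- Isomorphism classes of rooted trees with `n` vertices. -/
def RootedTreeClass (n : ℕ) : Type := Quotient (RootedTree.isoSetoid n)

/-- The series `𝒯_b`, `𝒯_w⁺`, `𝒯_w⁻` in `ℚ[t]⟦x⟧`, for `s = b`, `w₊`, `w₋`: the contributions to
`𝒯 = ∑_T W_T(t) x^{v(T)} / |Aut T|` (over rooted trees `T`) of the colorings in which the root is,
respectively, black, white with an even number of black children, white with an odd number of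
black children. -/
noncomputable def treeSeries (s : Kind) : PowerSeries ℚ[X] :=
  PowerSeries.mk fun n => ∑ᶠ q : RootedTreeClass n,
    Polynomial.C ((q.out.autCard : ℚ)⁻¹) * (q.out.partW s).map (Int.castRingHom ℚ)

/-- The multivariate power series `𝒵 = ∑_{n ≥ 1} W̃_{C_n}(b, w₋, w₊) / |Aut C_n|`, given by its
coefficients; each coefficient is a sum with finitely many nonzero terms. -/
noncomputable def cycleSeries : MvPowerSeries Kind ℚ :=
  fun d => ∑ᶠ n : ℕ,
    (((Multigraph.cycle (n + 1)).fullW.coeff d : ℤ) : ℚ) / ((Multigraph.cycle (n + 1)).autCard : ℚ)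

/-- The inclusion of `ℚ[t]⟦x⟧` in `ℚ[t, t⁻¹]⟦x⟧`. -/
noncomputable def toLaurentSeries : PowerSeries ℚ[X] →+* PowerSeries ℚ[T;T⁻¹] :=
  PowerSeries.map Polynomial.toLaurent

/-- The series in `ℚ[t, t⁻¹]⟦x⟧` that are substituted for the variables:
`b ← 𝒯_b`, `w₊ ← 𝒯_w⁺ + 𝒯_w⁻`, `w₋ ← t⁻¹ 𝒯_w⁺ + t 𝒯_w⁻`. -/
noncomputable def graft : Kind → PowerSeries ℚ[T;T⁻¹]
  | .b => toLaurentSeries (treeSeries .b)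
  | .wPlus => toLaurentSeries (treeSeries .wPlus) + toLaurentSeries (treeSeries .wMinus)
  | .wMinus =>
      PowerSeries.C (LaurentPolynomial.T (-1)) * toLaurentSeries (treeSeries .wPlus) +
        PowerSeries.C (LaurentPolynomial.T 1) * toLaurentSeries (treeSeries .wMinus)

end BlackWhite

/-! Sums over isomorphism classes weighted by 1/|Aut| are turned into sums over labelled structures
(`finsum_classes_eq`). A connected graph of Betti number 1 has as many edges as vertices, so its
edges can be oriented with exactly one edge leaving each vertex, which makes it the functional graph
of an endofunction. There are exactly two such orientations, one for each direction of the cycle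
(`card_orientations`). Hence the coefficient of x^N in 𝒲₁ is 1/(2·N!) times a sum over the connected
endofunctions of an N-set (`loopClass_sum`). In a rooted tree the orientation towards the root is
forced, so the corresponding factor is 1/N! (`treeClass_sum`).

An endofunction with a base point on its cycle of length n is the same as a map β to an n-set
together with a rooted tree on each fibre of β (`gluePointed_injective`, `gluePointed_surjective`).
Sums over such data are coefficients of products of n exponential generating functions
(`coeff_prod_egf`). Forgetting the base point divides by n (`sum_pointedFun`), and since |Aut C_n| =
2n (`autCard_cycle`), exactly the factor 1/2 of the orientations remains.

For the colors: among white vertices only the roots gain black neighbours when trees are joined,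
namely those on the cycle (`blackNbrs_glue`). An even gain changes nothing. An odd gain exchanges
the two kinds of white root, so the first loses a factor t and the second gains one; this is the
substitution for w₋ (`graftWeight_kindOf`).

The substitution is legitimate because the tree series have no constant term. As the polynomial of
C_n is homogeneous of degree n, only C_1, …, C_N affect the coefficient of x^N
(`coeff_subst_cycleSeries`). -/

namespace BlackWhite
namespace Multigraph

/-! ### Invariance under isomorphisms -/

section Invariance

variable {V H V' H' : Type*} {G : Multigraph V H} {G' : Multigraph V' H'}

theorem Iso.ext {e f : Iso G G'} (h₁ : e.onVert = f.onVert) (h₂ : e.onHalf = f.onHalf) :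
    e = f := by
  cases e; cases f; simp_all

instance [Finite V] [Finite H] : Finite (Iso G G') := by
  classical
  by_cases hne : Nonempty (Iso G G')
  · obtain ⟨e⟩ := hne
    have : Finite V' := Finite.of_equiv _ e.onVert
    have : Finite H' := Finite.of_equiv _ e.onHalf
    exact Finite.of_injective (fun e : Iso G G' => (e.onVert, e.onHalf)) fun a b hab =>
      Iso.ext (Prod.ext_iff.1 hab).1 (Prod.ext_iff.1 hab).2
  · exact @Finite.of_subsingleton _ ⟨fun a => (hne ⟨a⟩).elim⟩

theorem card_iso_eq_autCard (e : Iso G G') : Nat.card (Iso G G') = G'.autCard :=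
  Nat.card_congr
    { toFun := fun f => e.symm.trans f
      invFun := fun f => e.trans f
      left_inv := fun f => Iso.ext (by ext; simp [Iso.trans, Iso.symm])
        (by ext; simp [Iso.trans, Iso.symm])
      right_inv := fun f => Iso.ext (by ext; simp [Iso.trans, Iso.symm])
        (by ext; simp [Iso.trans, Iso.symm]) }

theorem Connected.of_iso (e : Iso G G') (hG : G.Connected) : G'.Connected := by
  obtain ⟨⟨v₀⟩, h⟩ := hG
  refine ⟨⟨e.onVert v₀⟩, fun u v => ?_⟩
  have := (h (e.onVert.symm u) (e.onVert.symm v)).lift e.onVert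
    (p := fun a b => ∃ h, G'.vert h = a ∧ G'.vert (G'.opp h) = b) (by
      rintro a b ⟨h, rfl, rfl⟩
      exact ⟨e.onHalf h, e.vert_comm h, by rw [e.opp_comm, e.vert_comm]⟩)
  simpa [Function.onFun] using this

variable [DecidableEq V] [Fintype H] [DecidableEq V'] [Fintype H']

theorem blackNbrs_of_iso (e : Iso G G') (c : V' → ZMod 2) (v : V) :
    G.blackNbrs (c ∘ e.onVert) v = G'.blackNbrs c (e.onVert v) := by
  unfold blackNbrs
  refine Finset.card_equiv e.onHalf fun h => ?_
  simp [e.vert_comm, e.opp_comm]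

theorem kind_of_iso (e : Iso G G') (c : V' → ZMod 2) (v : V) :
    G.kind (c ∘ e.onVert) v = G'.kind c (e.onVert v) := by
  simp [kind, blackNbrs_of_iso e]

variable [Fintype V] [Fintype V']

theorem card_admissible_of_iso (e : Iso G G') (c : V' → ZMod 2) :
    (G.admissible (c ∘ e.onVert)).card = (G'.admissible c).card := by
  refine Finset.card_equiv e.onVert fun v => ?_
  simp [admissible, blackNbrs_of_iso e]

theorem W_eq_sum_pow : G.W = ∑ c : V → ZMod 2, Polynomial.X ^ (G.admissible c).card := by
  simp [W]

theorem W_of_iso (e : Iso G G') : G.W = G'.W := by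
  rw [W_eq_sum_pow, W_eq_sum_pow]
  refine (Fintype.sum_equiv (e.onVert.arrowCongr (Equiv.refl (ZMod 2))).symm _ _ fun c => ?_).symm
  rw [← card_admissible_of_iso e c]
  rfl

end Invariance

/-! ### The Euler characteristic -/

section Euler

variable {V H : Type*} (G : Multigraph V H)

theorem opp_injective : Function.Injective G.opp :=
  fun a b h => by rw [← G.opp_opp a, h, G.opp_opp]

/-- A 1-chain is determined by its coefficients on one half-edge of each edge. -/
def oneChainsEquiv [LinearOrder H] : G.oneChains ≃ₗ[ℤ] ({h : H // h < G.opp h} → ℤ) where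
  toFun f h := f.1 h.1
  map_add' f g := rfl
  map_smul' a f := rfl
  invFun f := ⟨fun h => if hh : h < G.opp h then f ⟨h, hh⟩ else
      if hh : G.opp h < G.opp (G.opp h) then -f ⟨G.opp h, hh⟩ else 0, by
    intro h
    have := G.opp_opp h
    rcases lt_or_gt_of_ne (G.opp_ne h) with h1 | h1
    · simp [this, h1, h1.not_gt]
    · simp [this, h1, h1.not_gt]⟩
  left_inv f := by
    ext h
    have := G.opp_opp h
    have h2 := f.2 h
    rcases lt_or_gt_of_ne (G.opp_ne h) with h1 | h1
    · simp [this, h1, h1.not_gt, h2]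
    · simp [h1]
  right_inv f := by
    ext h
    simp [h.2]

theorem card_eq_two_mul [LinearOrder H] [Fintype H] :
    Fintype.card H = 2 * Fintype.card {h : H // h < G.opp h} := by
  have h1 := Fintype.card_subtype_compl (fun h : H => h < G.opp h)
  have h2 : Fintype.card {h : H // ¬ h < G.opp h} = Fintype.card {h : H // h < G.opp h} := by
    refine Fintype.card_congr ⟨fun h => ⟨G.opp h.1, ?_⟩, fun h => ⟨G.opp h.1, ?_⟩, ?_, ?_⟩
    · rw [G.opp_opp]; exact lt_of_le_of_ne (not_lt.1 h.2) (G.opp_ne _)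
    · rw [G.opp_opp]; exact h.2.not_gt
    · intro h; simp [G.opp_opp]
    · intro h; simp [G.opp_opp]
  have h3 := Fintype.card_subtype_le (fun h : H => h < G.opp h)
  omega

variable [DecidableEq V] [Fintype H]

theorem boundary_apply (f : G.oneChains) (v : V) :
    G.boundary f v = ∑ h : H with G.vert (G.opp h) = v, f.1 h := rfl

/-- The augmentation of 0-chains. -/
def augmentation (V : Type*) [Fintype V] : (V → ℤ) →ₗ[ℤ] ℤ where
  toFun f := ∑ v, f v
  map_add' f g := by simp [Finset.sum_add_distrib]
  map_smul' a f := by simp [Finset.mul_sum]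

theorem augmentation_boundary [Fintype V] (f : G.oneChains) :
    augmentation V (G.boundary f) = 0 := by
  have h1 : augmentation V (G.boundary f) = ∑ h : H, f.1 h := by
    change ∑ v, ∑ h : H with G.vert (G.opp h) = v, f.1 h = _
    exact Finset.sum_fiberwise _ _ _
  have h2 : ∑ h : H, f.1 h = ∑ h : H, f.1 (G.opp h) :=
    (Equiv.sum_comp (Function.Involutive.toPerm G.opp G.opp_opp) (fun h => f.1 h)).symm
  have h3 : ∑ h : H, f.1 (G.opp h) = - ∑ h : H, f.1 h := by
    rw [← Finset.sum_neg_distrib]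
    exact Finset.sum_congr rfl fun h _ => f.2 h
  rw [h1]
  omega

/-- The 1-chain of a single oriented edge. -/
def edgeChain [DecidableEq H] (h : H) : G.oneChains :=
  ⟨fun k => (if k = h then 1 else 0) - (if k = G.opp h then 1 else 0), fun k => by
    have h1 : G.opp k = h ↔ k = G.opp h :=
      ⟨fun e => by rw [← e, G.opp_opp], fun e => by rw [e, G.opp_opp]⟩
    have h2 : G.opp k = G.opp h ↔ k = h := G.opp_injective.eq_iff
    simp only [h1, h2]; ring⟩

theorem boundary_edgeChain [DecidableEq H] (h : H) :
    G.boundary (G.edgeChain h) = Pi.single (G.vert (G.opp h)) 1 - Pi.single (G.vert h) 1 := by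
  funext v
  rw [boundary_apply]
  simp [edgeChain, Finset.sum_sub_distrib, Finset.sum_ite_eq', G.opp_opp, Pi.single_apply,
    eq_comm (a := v)]

theorem range_boundary [Fintype V] (hG : G.Connected) :
    LinearMap.range G.boundary = LinearMap.ker (augmentation V) := by
  classical
  apply le_antisymm
  · rintro _ ⟨f, rfl⟩
    exact G.augmentation_boundary f
  · intro f hf
    obtain ⟨⟨r⟩, hconn⟩ := hG
    -- The boundaries of the edges of a walk from `r` to `v` telescope.
    have key : ∀ v, (Pi.single v 1 - Pi.single r 1 : V → ℤ) ∈ LinearMap.range G.boundary := by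
      intro v
      induction hconn r v with
      | refl => simp
      | tail _ hbc ih =>
        obtain ⟨h, rfl, rfl⟩ := hbc
        have := Submodule.add_mem _ ih ⟨G.edgeChain h, G.boundary_edgeChain h⟩
        simpa using this
    have hf0 : ∑ v, f v = 0 := hf
    -- The coefficients of `f` add up to zero, so subtracting the base point costs nothing.
    have : f = ∑ v, f v • (Pi.single v 1 - Pi.single r 1 : V → ℤ) := by
      simp only [smul_sub, Finset.sum_sub_distrib, ← Finset.sum_smul, hf0]
      funext w
      simp [Finset.sum_apply, Pi.single_apply]
    rw [this]
    exact Submodule.sum_mem _ fun v _ => Submodule.smul_mem _ _ (key v)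

theorem finrank_range_add_finrank_ker_int {M N : Type*} [AddCommGroup M] [Module.Finite ℤ M]
    [AddCommGroup N] (f : M →ₗ[ℤ] N) :
    Module.finrank ℤ (LinearMap.range f) + Module.finrank ℤ (LinearMap.ker f) =
      Module.finrank ℤ M := by
  rw [← f.quotKerEquivRange.finrank_eq, Submodule.finrank_quotient_add_finrank]

/-- Rank-nullity for the augmentation and for the boundary map, which are exact at the 0-chains by
connectedness. Counting half-edges and moving the 2 to the left avoids division and subtraction in
ℕ. -/
theorem euler [LinearOrder H] [Fintype V] (hG : G.Connected) :
    Fintype.card H + 2 = 2 * Fintype.card V + 2 * G.loopNumber := by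
  have h1 := finrank_range_add_finrank_ker_int (augmentation V)
  have : Module.Finite ℤ G.oneChains := Module.Finite.equiv G.oneChainsEquiv.symm
  have h2 := finrank_range_add_finrank_ker_int G.boundary
  obtain ⟨⟨r⟩, -⟩ := id hG
  have h3 : LinearMap.range (augmentation V) = ⊤ := by
    rw [LinearMap.range_eq_top]
    intro a
    exact ⟨Pi.single r a, by simp [augmentation]⟩
  rw [h3, finrank_top, Module.finrank_self, Module.finrank_fintype_fun_eq_card] at h1
  rw [G.range_boundary hG, G.oneChainsEquiv.finrank_eq, Module.finrank_fintype_fun_eq_card] at h2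
  rw [G.card_eq_two_mul, loopNumber]
  omega

end Euler

/-! ### Spanning trees -/

section Spanning

variable {V H : Type*} (G : Multigraph V H)

/-- Adjacency along half-edges in the set `S`. -/
def AdjIn (S : Set H) (a b : V) : Prop := ∃ h ∈ S, G.vert h = a ∧ G.vert (G.opp h) = b

/-- There is a walk of length `n` from `v` to `r` along half-edges in `S`. -/
def ReachIn (S : Set H) (r : V) : ℕ → V → Prop
  | 0, v => v = r
  | n + 1, v => ∃ w, G.AdjIn S v w ∧ ReachIn S r n w

/-- Take for `d` the distance to `r` within `S`, and for `p v` the first half-edge of a shortest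
walk. -/
theorem exists_parent (S : Set H) (r : V) (hS : ∀ v, Relation.ReflTransGen (G.AdjIn S) v r) :
    ∃ (p : {v // v ≠ r} → H) (d : V → ℕ), ∀ v : {v // v ≠ r},
      p v ∈ S ∧ G.vert (p v) = v ∧ d (G.vert (G.opp (p v))) < d v := by
  classical
  have hex : ∀ v, ∃ n, G.ReachIn S r n v := by
    intro v
    induction hS v using Relation.ReflTransGen.head_induction_on with
    | refl => exact ⟨0, rfl⟩
    | head hab _ ih => obtain ⟨n, hn⟩ := ih; exact ⟨n + 1, _, hab, hn⟩
  have hmin : ∀ v, ∃ n, G.ReachIn S r n v ∧ ∀ m, G.ReachIn S r m v → n ≤ m := fun v =>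
    ⟨Nat.find (hex v), Nat.find_spec (hex v), fun m hm => Nat.find_min' (hex v) hm⟩
  choose d hd hle using hmin
  have key : ∀ v : {v // v ≠ r}, ∃ h, h ∈ S ∧ G.vert h = v ∧ d (G.vert (G.opp h)) < d v := by
    rintro ⟨v, hv⟩
    have h1 := hd v
    generalize hn : d v = n at h1
    cases n with
    | zero => exact (hv h1).elim
    | succ n =>
      obtain ⟨w, ⟨h, hh, h2, rfl⟩, h3⟩ := h1
      exact ⟨h, hh, h2, Nat.lt_succ_of_le (hle _ _ h3)⟩
  choose p hp using key
  exact ⟨p, _, hp⟩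

end Spanning

end Multigraph
-- Cyclic points of endofunctions, and functional graphs
/-- Every point is mapped to `p` by some iterate of `f`. -/
def Reaches {V : Type*} (f : V → V) (p : V) : Prop := ∀ v, ∃ k, f^[k] v = p

theorem Reaches.map {V : Type*} {f : V → V} {p : V} (h : Reaches f p) : Reaches f (f p) := by
  intro v
  obtain ⟨k, hk⟩ := h v
  exact ⟨k + 1, by rw [Function.iterate_succ_apply', hk]⟩

theorem Reaches.of_iterate {V : Type*} {f : V → V} {p q : V} (h : Reaches f p) {k : ℕ}
    (hk : f^[k] p = q) : Reaches f q := by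
  intro v
  obtain ⟨j, hj⟩ := h v
  exact ⟨k + j, by rw [Function.iterate_add_apply, hj, hk]⟩

namespace Multigraph

variable {V H : Type*}

/-- The functional graph of `f`, with one edge from each vertex `v` to `f v`. -/
def ofFun (f : V → V) : Multigraph V (V × Bool) where
  vert h := if h.2 then f h.1 else h.1
  opp h := (h.1, !h.2)
  opp_opp h := by simp
  opp_ne h := by simp [Prod.ext_iff]

@[simp] theorem ofFun_vert_false (f : V → V) (v : V) : (ofFun f).vert (v, false) = v := rfl
@[simp] theorem ofFun_vert_true (f : V → V) (v : V) : (ofFun f).vert (v, true) = f v := rfl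
@[simp] theorem ofFun_opp (f : V → V) (h : V × Bool) : (ofFun f).opp h = (h.1, !h.2) := rfl

/-- The graph of a parent function: one edge from each vertex `v ≠ r` to `f v`. -/
def ofParent (f : V → V) (r : V) : Multigraph V ({v // v ≠ r} × Bool) where
  vert h := if h.2 then f h.1 else h.1
  opp h := (h.1, !h.2)
  opp_opp h := by simp
  opp_ne h := by simp [Prod.ext_iff]

@[simp] theorem ofParent_vert_false (f : V → V) (r : V) (v : {v // v ≠ r}) :
    (ofParent f r).vert (v, false) = v := rfl
@[simp] theorem ofParent_vert_true (f : V → V) (r : V) (v : {v // v ≠ r}) :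
    (ofParent f r).vert (v, true) = f v := rfl
@[simp] theorem ofParent_opp (f : V → V) (r : V) (h : {v // v ≠ r} × Bool) :
    (ofParent f r).opp h = (h.1, !h.2) := rfl

/-- Rename the half-edges. -/
def relabel {H' : Type*} (G : Multigraph V H) (e : H ≃ H') : Multigraph V H' where
  vert h := G.vert (e.symm h)
  opp h := e (G.opp (e.symm h))
  opp_opp h := by simp [G.opp_opp]
  opp_ne h := by rw [Ne, ← Equiv.eq_symm_apply]; exact G.opp_ne _

def relabelIso {H' : Type*} (G : Multigraph V H) (e : H ≃ H') : Iso G (G.relabel e) where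
  onVert := Equiv.refl V
  onHalf := e
  vert_comm h := by simp [relabel]
  opp_comm h := by simp [relabel]

theorem reflTransGen_symm {α : Type*} {R : α → α → Prop} (hR : ∀ a b, R a b → R b a) {a b : α}
    (h : Relation.ReflTransGen R a b) : Relation.ReflTransGen R b a := by
  induction h with
  | refl => exact .refl
  | tail _ hbc ih => exact .head (hR _ _ hbc) ih

theorem adjIn_univ (G : Multigraph V H) :
    G.AdjIn Set.univ = fun a b => ∃ h, G.vert h = a ∧ G.vert (G.opp h) = b := by
  funext a b
  simp [AdjIn]

theorem connected_of_adj {G : Multigraph V H} (p : V)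
    (h : ∀ v, Relation.ReflTransGen (fun a b => ∃ h, G.vert h = a ∧ G.vert (G.opp h) = b) v p) :
    G.Connected := by
  refine ⟨⟨p⟩, fun u v => (h u).trans (reflTransGen_symm ?_ (h v))⟩
  rintro _ _ ⟨k, rfl, rfl⟩
  exact ⟨G.opp k, rfl, by rw [G.opp_opp]⟩

theorem ofFun_connected_of_reaches {f : V → V} {p : V} (h : Reaches f p) :
    (ofFun f).Connected := by
  refine connected_of_adj p fun v => ?_
  obtain ⟨k, rfl⟩ := h v
  clear h
  induction k with
  | zero => exact .refl
  | succ k ih =>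
    rw [Function.iterate_succ_apply']
    exact ih.tail ⟨(_, false), rfl, rfl⟩

theorem ofParent_connected_of_reaches {f : V → V} {r : V} (h : Reaches f r) :
    (ofParent f r).Connected := by
  refine connected_of_adj r fun v => ?_
  obtain ⟨k, hk⟩ := h v
  clear h
  induction k generalizing v with
  | zero => rw [← hk]; exact .refl
  | succ k ih =>
    by_cases hv : v = r
    · rw [hv]
    · exact .head ⟨(⟨v, hv⟩, false), rfl, rfl⟩ (ih _ hk)

/-- By pigeonhole some orbit contains a periodic point `p`. The set of points whose orbit meets `p`
is closed under crossing edges in either direction, so it is everything. -/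
theorem exists_reaches_of_connected [Finite V] {f : V → V} (h : (ofFun f).Connected) :
    ∃ p, Reaches f p := by
  obtain ⟨⟨v₀⟩, hconn⟩ := h
  obtain ⟨a, b, hab, hne⟩ : ∃ a b, f^[a] v₀ = f^[b] v₀ ∧ a ≠ b := by
    simpa [Function.Injective] using not_injective_infinite_finite (fun k : ℕ => f^[k] v₀)
  wlog hlt : a < b generalizing a b
  · exact this b a hab.symm hne.symm (by omega)
  obtain ⟨m, rfl⟩ := Nat.exists_eq_add_of_lt hlt
  set p := f^[a] v₀ with hp
  -- `m + 1` is a period of `p`. This is needed in passing from `p` itself to `f p`, where there is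
  -- no step to drop.
  have hper : f^[m] (f p) = p := by
    rw [← Function.iterate_succ_apply, hp, ← Function.iterate_add_apply,
      show m.succ + a = a + m + 1 by omega, ← hab]
  refine ⟨p, fun v => ?_⟩
  induction hconn p v with
  | refl => exact ⟨0, rfl⟩
  | tail _ hbc ih =>
    obtain ⟨⟨u, b⟩, rfl, rfl⟩ := hbc
    obtain ⟨k, hk⟩ := ih
    cases b with
    | false =>
      cases k with
      | zero =>
        replace hk : u = p := hk
        exact ⟨m, by simpa [hk] using hper⟩
      | succ k => exact ⟨k, by simpa using hk⟩
    | true => exact ⟨k + 1, by simpa using hk⟩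

/-! ### Functional graphs represent all graphs of loop number one -/

/-- One of the two half-edges of the edge of `h`. -/
def side (G : Multigraph V H) (h : H) (b : Bool) : H := if b then G.opp h else h

theorem side_injective (G : Multigraph V H) {E : Type*} {p : E → H} (hp : Function.Injective p)
    (hopp : ∀ e e', p e ≠ G.opp (p e')) :
    Function.Injective fun x : E × Bool => G.side (p x.1) x.2 := by
  rintro ⟨e, b⟩ ⟨e', b'⟩ h
  cases b <;> cases b' <;> simp only [side, Bool.false_eq_true, if_true, if_false] at h
  · rw [hp h]
  · exact (hopp _ _ h).elim
  · exact (hopp _ _ h.symm).elim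
  · rw [hp (G.opp_injective h)]

/-- An orientation with exactly one outgoing edge at each vertex identifies a graph with a
functional graph. -/
noncomputable def isoOfOrientation (G : Multigraph V H) (p : V → H) (hp : ∀ v, G.vert (p v) = v)
    (hbij : Function.Bijective fun x : V × Bool => G.side (p x.1) x.2) :
    Iso (ofFun fun v => G.vert (G.opp (p v))) G where
  onVert := Equiv.refl V
  onHalf := Equiv.ofBijective _ hbij
  vert_comm := by rintro ⟨v, b⟩; cases b <;> simp [side, hp]
  opp_comm := by rintro ⟨v, b⟩; cases b <;> simp [side, G.opp_opp]

noncomputable def isoOfParents (G : Multigraph V H) (r : V) (p : {v // v ≠ r} → H)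
    (hp : ∀ v, G.vert (p v) = v)
    (hbij : Function.Bijective fun x : {v // v ≠ r} × Bool => G.side (p x.1) x.2)
    (f : V → V) (hf : ∀ v : {v // v ≠ r}, f v = G.vert (G.opp (p v))) :
    Iso (ofParent f r) G where
  onVert := Equiv.refl V
  onHalf := Equiv.ofBijective _ hbij
  vert_comm := by rintro ⟨v, b⟩; cases b <;> simp [side, hp, hf]
  opp_comm := by rintro ⟨v, b⟩; cases b <;> simp [side, G.opp_opp]

theorem parents_injective (G : Multigraph V H) {r : V} {p : {v // v ≠ r} → H}
    (hp : ∀ v, G.vert (p v) = v) : Function.Injective p := by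
  intro v w h
  apply Subtype.ext
  rw [← hp v, ← hp w, h]

/-- Otherwise the depth would decrease strictly along one edge in both directions. -/
theorem parents_ne_opp (G : Multigraph V H) {r : V} {p : {v // v ≠ r} → H} {d : V → ℕ}
    (hp : ∀ v, G.vert (p v) = v) (hd : ∀ v : {v // v ≠ r}, d (G.vert (G.opp (p v))) < d v)
    (v w : {v // v ≠ r}) : p v ≠ G.opp (p w) := by
  intro h
  have h1 := hd v
  have h2 := hd w
  rw [← h, hp] at h2
  rw [h, G.opp_opp, hp] at h1
  omega

theorem reaches_of_depth {f : V → V} {r : V} (d : V → ℕ) (hd : ∀ v, v ≠ r → d (f v) < d v) :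
    Reaches f r := by
  intro v
  induction hn : d v using Nat.strong_induction_on generalizing v with
  | _ n ih =>
    by_cases hv : v = r
    · exact ⟨0, hv⟩
    · obtain ⟨k, hk⟩ := ih _ (hn ▸ hd v hv) (f v) rfl
      exact ⟨k + 1, hk⟩

/-- The parent edges are |V| - 1 distinct edges, and by Euler's formula there are no others. -/
theorem exists_ofParent_iso [Fintype V] [DecidableEq V] [Fintype H] [LinearOrder H]
    (G : Multigraph V H) (hG : G.Connected) (h0 : G.loopNumber = 0) (r : V) :
    ∃ f : V → V, f r = r ∧ Reaches f r ∧ ∃ e : Iso (ofParent f r) G, e.onVert = Equiv.refl V := by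
  have heuler := G.euler hG
  obtain ⟨p, d, hpd⟩ := G.exists_parent Set.univ r (fun v => by rw [adjIn_univ]; exact hG.2 v r)
  have hp : ∀ v, G.vert (p v) = v := fun v => (hpd v).2.1
  have hd : ∀ v : {v // v ≠ r}, d (G.vert (G.opp (p v))) < d v := fun v => (hpd v).2.2
  let f : V → V := fun v => if hv : v = r then r else G.vert (G.opp (p ⟨v, hv⟩))
  have hf : ∀ v : {v // v ≠ r}, f v = G.vert (G.opp (p v)) := fun v => by simp [f, v.2]
  have hbij : Function.Bijective fun x : {v // v ≠ r} × Bool => G.side (p x.1) x.2 := by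
    rw [Fintype.bijective_iff_injective_and_card]
    refine ⟨G.side_injective (G.parents_injective hp) (G.parents_ne_opp hp hd), ?_⟩
    have : 0 < Fintype.card V := Fintype.card_pos_iff.2 ⟨r⟩
    simp [Fintype.card_subtype_compl]
    omega
  exact ⟨f, by simp [f], reaches_of_depth d fun v hv => by rw [hf ⟨v, hv⟩]; exact hd ⟨v, hv⟩,
    G.isoOfParents r p hp hbij f hf, rfl⟩

/-- A spanning tree misses one edge. Reroot the tree at an end of that edge and let the edge be the
one leaving the new root; then each vertex has exactly one outgoing edge. -/
theorem exists_ofFun_iso [Fintype V] [DecidableEq V] [Fintype H] [LinearOrder H]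
    (G : Multigraph V H) (hG : G.Connected) (h1 : G.loopNumber = 1) :
    ∃ f : V → V, Nonempty (Iso (ofFun f) G) := by
  have heuler := G.euler hG
  obtain ⟨⟨r₀⟩, -⟩ := id hG
  have hV : 0 < Fintype.card V := Fintype.card_pos_iff.2 ⟨r₀⟩
  obtain ⟨p, d, hpd⟩ := G.exists_parent Set.univ r₀ (fun v => by rw [adjIn_univ]; exact hG.2 v r₀)
  let S : Set H := Set.range fun x : {v // v ≠ r₀} × Bool => G.side (p x.1) x.2
  have hsymm : ∀ a b, G.AdjIn S a b → G.AdjIn S b a := by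
    rintro _ _ ⟨_, ⟨⟨v, b⟩, rfl⟩, rfl, rfl⟩
    exact ⟨_, ⟨⟨v, !b⟩, rfl⟩, by cases b <;> simp [side, G.opp_opp]⟩
  have hroot : ∀ v, Relation.ReflTransGen (G.AdjIn S) v r₀ := by
    intro v
    induction hn : d v using Nat.strong_induction_on generalizing v with
    | _ n ih =>
      by_cases hv : v = r₀
      · rw [hv]
      · exact .head ⟨p ⟨v, hv⟩, ⟨(⟨v, hv⟩, false), rfl⟩, (hpd ⟨v, hv⟩).2.1, rfl⟩
          (ih _ (hn ▸ (hpd ⟨v, hv⟩).2.2) _ rfl)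
  -- The tree accounts for at most 2(|V| - 1) half-edges, while Euler's formula gives 2|V|.
  obtain ⟨h₀, hh₀⟩ : ∃ h₀, h₀ ∉ S := by
    by_contra! hS
    have := Fintype.card_le_of_surjective _ (Set.range_eq_univ.1 (Set.eq_univ_of_forall hS))
    simp [Fintype.card_subtype_compl] at this
    omega
  have hopp : ∀ h ∈ S, G.opp h ∈ S := by
    rintro _ ⟨⟨v, b⟩, rfl⟩
    exact ⟨⟨v, !b⟩, by cases b <;> simp [side, G.opp_opp]⟩
  have hh₀' : G.opp h₀ ∉ S := fun h => hh₀ (G.opp_opp h₀ ▸ hopp _ h)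
  obtain ⟨q, d', hq⟩ := G.exists_parent S (G.vert h₀)
    (fun v => (hroot v).trans (reflTransGen_symm hsymm (hroot _)))
  have hqv : ∀ v, G.vert (q v) = v := fun v => (hq v).2.1
  let p' : V → H := fun v => if hv : v = G.vert h₀ then h₀ else q ⟨v, hv⟩
  have hp' : ∀ v, G.vert (p' v) = v := by
    intro v
    by_cases hv : v = G.vert h₀
    · simp [p', hv]
    · simp [p', hv, hqv]
  refine ⟨_, ⟨G.isoOfOrientation p' hp' ?_⟩⟩
  rw [Fintype.bijective_iff_injective_and_card]
  refine ⟨G.side_injective (fun v w h => by rw [← hp' v, h, hp']) fun v w h => ?_, ?_⟩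
  · by_cases hv : v = G.vert h₀ <;> by_cases hw : w = G.vert h₀
    · simp only [p', hv, hw, dif_pos] at h
      exact G.opp_ne _ h.symm
    · simp only [p', hv, hw, dif_pos, dif_neg, not_false_eq_true] at h
      exact hh₀ (h ▸ hopp _ (hq _).1)
    · simp only [p', hv, hw, dif_pos, dif_neg, not_false_eq_true] at h
      exact hh₀' (h ▸ (hq _).1)
    · simp only [p', hv, hw, dif_neg, not_false_eq_true] at h
      exact G.parents_ne_opp hqv (fun v => (hq v).2.2) _ _ h
  · simp
    omega

end Multigraph
-- The labelled structures and the isomorphisms between them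
/-- The endofunctions whose functional graph is connected. -/
abbrev ConnFun (V : Type*) := {f : V → V // (Multigraph.ofFun f).Connected}

/-- The parent functions of rooted trees; the root is mapped to itself. -/
abbrev TreeFun (V : Type*) := {x : (V → V) × V // x.1 x.2 = x.2 ∧ Reaches x.1 x.2}

noncomputable instance (V : Type*) [Finite V] : Fintype (ConnFun V) := Fintype.ofFinite _

noncomputable instance (V : Type*) [Finite V] : Fintype (TreeFun V) := Fintype.ofFinite _

namespace Multigraph

variable {V : Type*}

/-! ### Isomorphisms between functional graphs -/

/-- The endpoint of the edge of `u` that is selected by `a`. -/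
def endpoint (f : V → V) (a : V → Bool) (u : V) : V := if a u then f u else u

section FunIso

variable {V₀ : Type*} {f : V → V} {f₀ : V₀ → V₀}

theorem onHalf_not (e : Iso (ofFun f) (ofFun f₀)) (v : V) (b : Bool) :
    e.onHalf (v, !b) = ((e.onHalf (v, b)).1, !(e.onHalf (v, b)).2) :=
  (e.opp_comm (v, b)).symm

/-- The edges that are reversed by an isomorphism. -/
def reversed (e : Iso (ofFun f) (ofFun f₀)) (u : V₀) : Bool := (e.onHalf.symm (u, false)).2

theorem onHalf_symm_fst (e : Iso (ofFun f) (ofFun f₀)) (u : V₀) :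
    e.onHalf ((e.onHalf.symm (u, false)).1, false) = (u, reversed e u) := by
  have h : e.onHalf ((e.onHalf.symm (u, false)).1, reversed e u) = (u, false) :=
    e.onHalf.apply_symm_apply _
  cases hb : reversed e u with
  | false => rw [hb] at h; exact h
  | true =>
    rw [hb] at h
    simpa [h] using onHalf_not e (e.onHalf.symm (u, false)).1 true

/-- The selected endpoint is the vertex that the edge leaves in the orientation carried over from
`f`. One edge leaves each vertex there, whence the injectivity below. -/
theorem endpoint_reversed (e : Iso (ofFun f) (ofFun f₀)) (u : V₀) :
    endpoint f₀ (reversed e) u = e.onVert (e.onHalf.symm (u, false)).1 := by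
  have h := e.vert_comm ((e.onHalf.symm (u, false)).1, false)
  rw [onHalf_symm_fst] at h
  exact h

theorem endpoint_reversed_injective (e : Iso (ofFun f) (ofFun f₀)) :
    Function.Injective (endpoint f₀ (reversed e)) := by
  intro u u' h
  rw [endpoint_reversed, endpoint_reversed, e.onVert.injective.eq_iff] at h
  have := onHalf_symm_fst e u
  rw [h, onHalf_symm_fst] at this
  exact (Prod.ext_iff.1 this).1.symm

end FunIso

/-- The isomorphism determined by a bijection of the vertices and a choice of reversed edges. -/
noncomputable def isoOfReversed (f₀ : V → V) (a : V → Bool)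
    (ha : Function.Bijective (endpoint f₀ a)) (σ : Equiv.Perm V) :
    Iso (ofFun fun v => σ.symm (endpoint f₀ (fun u => !a u) ((Equiv.ofBijective _ ha).symm (σ v))))
      (ofFun f₀) where
  onVert := σ
  onHalf :=
    { toFun := fun h => ((Equiv.ofBijective _ ha).symm (σ h.1),
        xor h.2 (a ((Equiv.ofBijective _ ha).symm (σ h.1))))
      invFun := fun h => (σ.symm (endpoint f₀ a h.1), xor h.2 (a h.1))
      left_inv := fun h => by
        have := (Equiv.ofBijective _ ha).apply_symm_apply (σ h.1)
        rw [Equiv.ofBijective_apply] at this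
        simp [this]
      right_inv := fun h => by
        have := (Equiv.ofBijective _ ha).symm_apply_apply h.1
        rw [Equiv.ofBijective_apply] at this
        simp [this] }
  vert_comm := by
    rintro ⟨v, b⟩
    have := (Equiv.ofBijective _ ha).apply_symm_apply (σ v)
    rw [Equiv.ofBijective_apply] at this
    cases b
    · simpa [ofFun, endpoint] using this
    · simp [ofFun, endpoint]
  opp_comm := by rintro ⟨v, b⟩; simp

/-- An isomorphism from a functional graph amounts to a bijection of the vertices and an orientation
of the target with one outgoing edge at each vertex; these two recover `f`. -/
theorem card_sigma_iso [Fintype V] (f₀ : ConnFun V) :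
    Nat.card (Σ f : ConnFun V, Iso (ofFun f.1) (ofFun f₀.1)) =
      Nat.card {a : V → Bool // Function.Bijective (endpoint f₀.1 a)} *
        (Fintype.card V).factorial := by
  classical
  rw [← Fintype.card_perm, ← Nat.card_eq_fintype_card, ← Nat.card_prod]
  refine Nat.card_congr (Equiv.ofBijective (fun x => (⟨reversed x.2,
    Finite.injective_iff_bijective.1 (endpoint_reversed_injective x.2)⟩, x.2.onVert)) ⟨?_, ?_⟩)
  · rintro ⟨⟨f, hf⟩, e⟩ ⟨⟨f', hf'⟩, e'⟩ h
    simp only [Prod.mk.injEq, Subtype.mk.injEq] at h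
    obtain ⟨hrev, hvert⟩ := h
    have h1 : ∀ u, (e.onHalf.symm (u, false)).1 = (e'.onHalf.symm (u, false)).1 := by
      intro u
      apply e.onVert.injective
      rw [← endpoint_reversed, hrev, endpoint_reversed, hvert]
    have h2 : ∀ u, e.onHalf.symm (u, false) = e'.onHalf.symm (u, false) := fun u =>
      Prod.ext (h1 u) (congrFun hrev u)
    have h3 : e.onHalf.symm = e'.onHalf.symm := by
      ext1 ⟨u, b⟩
      cases b with
      | false => exact h2 u
      | true =>
        have k1 := onHalf_not e.symm u false
        have k2 := onHalf_not e'.symm u false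
        exact k1.trans (Eq.trans (by simp [Iso.symm, h2]) k2.symm)
    have h4 : e.onHalf = e'.onHalf := by rw [← e.onHalf.symm_symm, h3, Equiv.symm_symm]
    have h5 : f = f' := by
      funext v
      apply e.onVert.injective
      have k1 := e.vert_comm (v, true)
      have k2 := e'.vert_comm (v, true)
      rw [← h4, ← hvert] at k2
      exact k1.symm.trans k2
    subst h5
    rw [Iso.ext hvert h4]
  · rintro ⟨⟨a, ha⟩, σ⟩
    refine ⟨⟨⟨_, Connected.of_iso (isoOfReversed f₀.1 a ha σ).symm f₀.2⟩,
      isoOfReversed f₀.1 a ha σ⟩, ?_⟩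
    ext u <;> simp [isoOfReversed, reversed]

/-- The points satisfying `Reaches f` are those on the cycle, and each has a predecessor there. -/
theorem exists_reaches_apply_eq {f : V → V} {q : V} (hq : Reaches f q) :
    ∃ w, Reaches f w ∧ f w = q := by
  obtain ⟨k, hk⟩ := hq (f q)
  refine ⟨f^[k] q, hq.of_iterate rfl, ?_⟩
  exact (Function.iterate_succ_apply' f k q).symm.trans hk

/-- Either no edge is reversed or precisely the edges of the cycle are. A loop also gives two
choices, since its flip is recorded by `a` though the endpoint does not change. -/
theorem card_orientations [Finite V] (f₀ : ConnFun V) :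
    Nat.card {a : V → Bool // Function.Bijective (endpoint f₀.1 a)} = 2 := by
  classical
  obtain ⟨f, hf⟩ := f₀
  obtain ⟨p, hp⟩ := exists_reaches_of_connected hf
  -- A reversed edge leaves from its head, so the edge that left from there must be reversed too.
  have hcl : ∀ a : V → Bool, Function.Bijective (endpoint f a) → ∀ u, a u = true →
      ∀ k, a (f^[k] u) = true := by
    intro a ha u hu k
    induction k with
    | zero => exact hu
    | succ k ih =>
      rw [Function.iterate_succ_apply']
      by_contra hne
      have : f (f^[k] u) = f^[k] u := ha.1 (by simp [endpoint, ih, hne])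
      rw [this] at hne
      exact hne ih
  have h1 : Function.Bijective (endpoint f fun u => decide (Reaches f u)) := by
    rw [← Finite.surjective_iff_bijective]
    intro u
    by_cases hu : Reaches f u
    · obtain ⟨w, hw, rfl⟩ := exists_reaches_apply_eq hu
      exact ⟨w, by simp [endpoint, hw]⟩
    · exact ⟨u, by simp [endpoint, hu]⟩
  have h0 : Function.Bijective (endpoint f fun _ => false) := by
    have : endpoint f (fun _ => false) = id := by funext u; simp [endpoint]
    rw [this]
    exact Function.bijective_id
  have hchar : ∀ a : V → Bool, Function.Bijective (endpoint f a) →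
      a = (fun _ => false) ∨ a = fun u => decide (Reaches f u) := by
    intro a ha
    by_cases hex : ∃ u, a u = true
    · right
      obtain ⟨u₀, hu₀⟩ := hex
      have hsub : ∀ q, Reaches f q → a q = true := by
        intro q hq
        obtain ⟨k, rfl⟩ := hq u₀
        exact hcl a ha u₀ hu₀ k
      -- If `f u` is on the cycle, its predecessor there also has a reversed edge leaving from `f
      -- u`, so that predecessor is `u`.
      have hsup : ∀ k u, a u = true → f^[k] u = p → Reaches f u := by
        intro k
        induction k with
        | zero => rintro u - rfl; exact hp
        | succ k ih =>
          intro u hu hk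
          obtain ⟨w, hw, hwu⟩ := exists_reaches_apply_eq (ih (f u) (hcl a ha u hu 1) hk)
          have : w = u := ha.1 (by simp [endpoint, hu, hsub w hw, hwu])
          exact this ▸ hw
      funext u
      by_cases hu : Reaches f u
      · simp [hu, hsub u hu]
      · simp only [hu, decide_false]
        by_contra hne
        obtain ⟨k, hk⟩ := hp u
        exact hu (hsup k u (by simpa using hne) hk)
    · left
      funext u
      simpa using not_exists.1 hex u
  have hset : {a : V → Bool | Function.Bijective (endpoint f a)} =
      {(fun _ => false), fun u => decide (Reaches f u)} := by
    ext a
    refine ⟨hchar a, ?_⟩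
    rintro (rfl | rfl)
    exacts [h0, h1]
  change Nat.card ↥{a : V → Bool | Function.Bijective (endpoint f a)} = 2
  rw [hset, Nat.card_coe_set_eq, Set.ncard_pair]
  intro h
  simpa [hp] using congrFun h p

/-! ### Isomorphisms between rooted trees -/

/-- Isomorphisms that map the root `r` to the root `r'`. -/
abbrev RootedIso {H V' H' : Type*} (G : Multigraph V H) (r : V) (G' : Multigraph V' H') (r' : V') :=
  {e : Iso G G' // e.onVert r = r'}

theorem parent_onHalf_not {f f₀ : V → V} {r r₀ : V} (e : Iso (ofParent f r) (ofParent f₀ r₀))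
    (v : {v // v ≠ r}) (b : Bool) :
    e.onHalf (v, !b) = ((e.onHalf (v, b)).1, !(e.onHalf (v, b)).2) :=
  (e.opp_comm (v, b)).symm

theorem onVert_ne {H V' H' : Type*} {G : Multigraph V H} {G' : Multigraph V' H'} (e : Iso G G')
    {r v : V} {r' : V'} (he : e.onVert r = r') (hv : v ≠ r) : e.onVert v ≠ r' :=
  fun h => hv (e.onVert.injective (h.trans he.symm))

/-- No parent edge is reversed, by induction on the distance to the root: the edge of `f₀ u` leaves
from `f₀ u`, and a reversed edge of `u` would be a second one leaving from there. -/
theorem parent_onHalf_symm {f f₀ : V → V} {r r₀ : V} (hf₀ : Reaches f₀ r₀)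
    (e : Iso (ofParent f r) (ofParent f₀ r₀)) (he : e.onVert r = r₀) (u : {v // v ≠ r₀}) :
    (e.onHalf.symm (u, false)).2 = false ∧ e.onVert (e.onHalf.symm (u, false)).1 = u := by
  have hfst : ∀ u, e.onHalf ((e.onHalf.symm (u, false)).1, false) =
      (u, (e.onHalf.symm (u, false)).2) := by
    intro u
    have h := e.onHalf.apply_symm_apply (u, false)
    generalize e.onHalf.symm (u, false) = x at h ⊢
    obtain ⟨w, b⟩ := x
    cases b with
    | false => exact h
    | true => simpa [h] using parent_onHalf_not e w true
  have hend : ∀ u : {v // v ≠ r₀}, e.onVert (e.onHalf.symm (u, false)).1 =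
      if (e.onHalf.symm (u, false)).2 then f₀ u else u := by
    intro u
    have h := e.vert_comm ((e.onHalf.symm (u, false)).1, false)
    rw [hfst] at h
    exact h.symm
  suffices h : ∀ k (u : {v // v ≠ r₀}), f₀^[k] u = r₀ → (e.onHalf.symm (u, false)).2 = false by
    obtain ⟨k, hk⟩ := hf₀ u
    have h' := h k u hk
    exact ⟨h', by rw [hend, h']; rfl⟩
  intro k
  induction k with
  | zero => intro u hu; exact (u.2 hu).elim
  | succ k ih =>
    intro u hu
    by_contra hne
    have hne' : (e.onHalf.symm (u, false)).2 = true := by simpa using hne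
    have h1 := hend u
    rw [hne', if_pos rfl] at h1
    have h2 : f₀ u ≠ r₀ := by
      rw [← h1]
      exact onVert_ne e he (e.onHalf.symm (u, false)).1.2
    have h3 := ih ⟨f₀ u, h2⟩ hu
    have h4 := hend ⟨f₀ u, h2⟩
    rw [h3, if_neg (by simp)] at h4
    replace h4 := e.onVert.injective (h4.trans h1.symm)
    have h5 := hfst ⟨f₀ u, h2⟩
    rw [Subtype.ext h4, hfst, h3, hne'] at h5
    simpa using (Prod.ext_iff.1 h5).2

theorem parent_onHalf {f f₀ : V → V} {r r₀ : V} (hf₀ : Reaches f₀ r₀)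
    (e : Iso (ofParent f r) (ofParent f₀ r₀)) (he : e.onVert r = r₀) (v : {v // v ≠ r}) :
    e.onHalf (v, false) = (⟨e.onVert v, onVert_ne e he v.2⟩, false) := by
  obtain ⟨h1, h2⟩ := parent_onHalf_symm hf₀ e he
    ⟨e.onVert v, onVert_ne e he v.2⟩
  rw [← Equiv.eq_symm_apply]
  refine Prod.ext (Subtype.ext (e.onVert.injective h2.symm)) h1.symm

/-- The isomorphism determined by a bijection of the vertices. -/
def isoOfPerm (f₀ : V → V) (r₀ : V) (σ : Equiv.Perm V) :
    Iso (ofParent (fun v => σ.symm (f₀ (σ v))) (σ.symm r₀)) (ofParent f₀ r₀) where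
  onVert := σ
  onHalf := (σ.subtypeEquiv fun v => by simp [Equiv.eq_symm_apply]).prodCongr (Equiv.refl Bool)
  vert_comm := by rintro ⟨v, b⟩; cases b <;> simp
  opp_comm := by rintro ⟨v, b⟩; simp

/-- As no edge is reversed, the vertex bijection determines everything, and each permutation arises
by conjugating the parent function. -/
theorem card_sigma_rootedIso [Fintype V] (x₀ : TreeFun V) :
    Nat.card (Σ x : TreeFun V, RootedIso (ofParent x.1.1 x.1.2) x.1.2
      (ofParent x₀.1.1 x₀.1.2) x₀.1.2) = (Fintype.card V).factorial := by
  classical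
  obtain ⟨⟨f₀, r₀⟩, hr₀, hf₀⟩ := x₀
  rw [← Fintype.card_perm, ← Nat.card_eq_fintype_card]
  refine Nat.card_congr (Equiv.ofBijective (fun x => x.2.1.onVert) ⟨?_, ?_⟩)
  · rintro ⟨⟨⟨f, r⟩, hr, hf⟩, e, he⟩ ⟨⟨⟨f', r'⟩, hr', hf'⟩, e', he'⟩ h
    dsimp only at hr hr' he he' hr₀ h e e'
    have h1 : r = r' := e.onVert.injective (by rw [he, h, he'])
    -- The convention that roots are fixed gives the conjugation at the root, where no edge provides
    -- it.
    have hconj : ∀ {f r} (e : Iso (ofParent f r) (ofParent f₀ r₀)) (_ : f r = r)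
        (_ : e.onVert r = r₀) (v : V), e.onVert (f v) = f₀ (e.onVert v) := by
      intro f r e hr he v
      by_cases hv : v = r
      · rw [hv, hr, he, hr₀]
      · have k1 := e.vert_comm (⟨v, hv⟩, true)
        have k2 := parent_onHalf_not e ⟨v, hv⟩ false
        rw [parent_onHalf hf₀ e he] at k2
        rw [Bool.not_false] at k2
        rw [k2] at k1
        exact k1.symm
    have h2 : f = f' := by
      funext v
      apply e.onVert.injective
      rw [hconj e hr he, h, hconj e' hr' he']
    subst h1 h2
    have h3 : e = e' := by
      refine Iso.ext h ?_
      ext1 ⟨v, b⟩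
      have k := parent_onHalf hf₀ e he v
      have k' := parent_onHalf hf₀ e' he' v
      simp only [← h] at k'
      cases b with
      | false => rw [k, k']
      | true =>
        have l := parent_onHalf_not e v false
        have l' := parent_onHalf_not e' v false
        rw [k] at l
        rw [k'] at l'
        exact l.trans l'.symm
    subst h3
    rfl
  · intro σ
    refine ⟨⟨⟨⟨fun v => σ.symm (f₀ (σ v)), σ.symm r₀⟩, by simpa using hr₀, fun v => ?_⟩,
      isoOfPerm f₀ r₀ σ, by simp [isoOfPerm]⟩, rfl⟩
    obtain ⟨k, hk⟩ := hf₀ (σ v)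
    refine ⟨k, σ.injective ?_⟩
    have : Function.Semiconj σ (fun v => σ.symm (f₀ (σ v))) f₀ := fun v => by simp
    rw [this.iterate_right k v, hk, Equiv.apply_symm_apply]

end Multigraph
/-! ### Sums over isomorphism classes as sums over labelled structures -/

/-- If the class `q` is represented by labelled objects whose isomorphisms onto a representative are
counted by `I`, then weighted sums over classes become sums over labelled objects. -/
theorem finsum_classes_eq {X Q M : Type*} [Fintype X] [CommRing M] [Algebra ℚ M] (cls : X → Q)
    (I : X → Q → ℕ) (aut : Q → ℕ) (K : ℕ) (hK : K ≠ 0)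
    (h1 : ∀ x q, cls x = q → I x q = aut q) (h0 : ∀ x q, cls x ≠ q → I x q = 0)
    (hI : ∀ q, ∑ x, I x q = K) (φ : Q → M) :
    Finite Q ∧ ∑ᶠ q, algebraMap ℚ M ((aut q : ℚ)⁻¹) * φ q =
      algebraMap ℚ M ((K : ℚ)⁻¹) * ∑ x, φ (cls x) := by
  classical
  have hsurj : Function.Surjective cls := by
    intro q
    by_contra! hq
    apply hK
    rw [← hI q]
    exact Finset.sum_eq_zero fun x _ => h0 x q (hq x)
  have hfin : Finite Q := Finite.of_surjective cls hsurj
  have := Fintype.ofFinite Q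
  refine ⟨hfin, ?_⟩
  -- Orbit counting: only the labelled objects in the class `q` contribute to `hI q`, each with `aut
  -- q`.
  have hcount : ∀ q, (Finset.univ.filter fun x => cls x = q).card * aut q = K := by
    intro q
    rw [← hI q, Finset.card_eq_sum_ones, Finset.sum_filter, Finset.sum_mul]
    refine Finset.sum_congr rfl fun x _ => ?_
    by_cases hx : cls x = q
    · simp [hx, h1 x q hx]
    · simp [hx, h0 x q hx]
  rw [finsum_eq_sum_of_fintype, ← Finset.sum_fiberwise (g := cls) (f := fun x => φ (cls x)),
    Finset.mul_sum]
  refine Finset.sum_congr rfl fun q _ => ?_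
  have h2 : ∑ x with cls x = q, φ (cls x) =
      algebraMap ℚ M ((Finset.univ.filter fun x => cls x = q).card : ℚ) * φ q := by
    rw [Finset.sum_congr rfl fun x hx => by rw [(Finset.mem_filter.1 hx).2], Finset.sum_const,
      nsmul_eq_mul, map_natCast]
  rw [h2, ← mul_assoc, ← map_mul]
  congr 2
  have h3 := hcount q
  have h4 : (aut q : ℚ) ≠ 0 := by
    intro h; apply hK; rw [← h3, Nat.cast_eq_zero.1 h, mul_zero]
  have h5 : (K : ℚ) ≠ 0 := Nat.cast_ne_zero.2 hK
  have h6 : ((Finset.univ.filter fun x => cls x = q).card : ℚ) * aut q = K := by exact_mod_cast h3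
  field_simp
  linarith

/-! ### Labelled count of graphs of loop number one -/

namespace Multigraph

theorem ofFun_loopNumber {V : Type*} [Fintype V] [DecidableEq V] {f : V → V} {n : ℕ}
    (e : V × Bool ≃ Fin n) (hf : (ofFun f).Connected) : ((ofFun f).relabel e).loopNumber = 1 := by
  have h := ((ofFun f).relabel e).euler (hf.of_iso (relabelIso _ e))
  have h2 := Fintype.card_congr e
  simp only [Fintype.card_prod, Fintype.card_bool] at h2
  omega

theorem ofParent_loopNumber {V : Type*} [Fintype V] [DecidableEq V] {f : V → V} {r : V} {n : ℕ}
    (e : {v // v ≠ r} × Bool ≃ Fin n) (hf : (ofParent f r).Connected) :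
    ((ofParent f r).relabel e).loopNumber = 0 := by
  have h := ((ofParent f r).relabel e).euler (hf.of_iso (relabelIso _ e))
  have h2 := Fintype.card_congr e
  have : 0 < Fintype.card V := Fintype.card_pos_iff.2 ⟨r⟩
  simp only [Fintype.card_prod, Fintype.card_bool, ne_eq, Fintype.card_subtype_compl,
    Fintype.card_subtype_eq] at h2
  omega

end Multigraph

open Multigraph

/-- The graph of loop number one of a connected endofunction. -/
noncomputable def LoopGraph.ofConnFun {n : ℕ} (f : ConnFun (Fin n)) : LoopGraph 1 n where
  numHalf := _
  graph := (ofFun f.1).relabel (Fintype.equivFin (Fin n × Bool))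
  connected := f.2.of_iso (relabelIso _ _)
  loopNumber_eq := ofFun_loopNumber _ f.2

theorem card_rootedIso_congr {V H V' H' V'' H'' : Type*} {G : Multigraph V H}
    {G' : Multigraph V' H'} {G'' : Multigraph V'' H''} {r : V} {r' : V'} {r'' : V''}
    (e : RootedIso G r G' r') :
    Nat.card (RootedIso G'' r'' G r) = Nat.card (RootedIso G'' r'' G' r') :=
  Nat.card_congr
    { toFun := fun f => ⟨f.1.trans e.1, by simp [Iso.trans, f.2, e.2]⟩
      invFun := fun f => ⟨f.1.trans e.1.symm, by simp [Iso.trans, Iso.symm, f.2, ← e.2]⟩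
      left_inv := fun f => Subtype.ext <| Iso.ext (by ext; simp [Iso.trans, Iso.symm])
        (by ext; simp [Iso.trans, Iso.symm])
      right_inv := fun f => Subtype.ext <| Iso.ext (by ext; simp [Iso.trans, Iso.symm])
        (by ext; simp [Iso.trans, Iso.symm]) }

theorem card_rootedIso_congr_left {V H V' H' V'' H'' : Type*} {G : Multigraph V H}
    {G' : Multigraph V' H'} {G'' : Multigraph V'' H''} {r : V} {r' : V'} {r'' : V''}
    (e : RootedIso G r G' r') :
    Nat.card (RootedIso G r G'' r'') = Nat.card (RootedIso G' r' G'' r'') :=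
  Nat.card_congr
    { toFun := fun f => ⟨e.1.symm.trans f.1, by simp [Iso.trans, Iso.symm, f.2, ← e.2]⟩
      invFun := fun f => ⟨e.1.trans f.1, by simp [Iso.trans, f.2, e.2]⟩
      left_inv := fun f => Subtype.ext <| Iso.ext (by ext; simp [Iso.trans, Iso.symm])
        (by ext; simp [Iso.trans, Iso.symm])
      right_inv := fun f => Subtype.ext <| Iso.ext (by ext; simp [Iso.trans, Iso.symm])
        (by ext; simp [Iso.trans, Iso.symm]) }

theorem card_iso_congr {V H V' H' V'' H'' : Type*} {G : Multigraph V H}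
    {G' : Multigraph V' H'} {G'' : Multigraph V'' H''} (e : Iso G G') :
    Nat.card (Iso G'' G) = Nat.card (Iso G'' G') :=
  Nat.card_congr
    { toFun := fun f => f.trans e
      invFun := fun f => f.trans e.symm
      left_inv := fun f => Iso.ext (by ext; simp [Iso.trans, Iso.symm])
        (by ext; simp [Iso.trans, Iso.symm])
      right_inv := fun f => Iso.ext (by ext; simp [Iso.trans, Iso.symm])
        (by ext; simp [Iso.trans, Iso.symm]) }

/-- Each class receives `2 * n!` isomorphisms from functional graphs: two orientations times `n!`
labellings. -/
theorem loopClass_sum (n : ℕ) : Finite (LoopClass 1 n) ∧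
    PowerSeries.coeff n (loopSeries 1) = Polynomial.C (((2 * n.factorial : ℕ) : ℚ)⁻¹) *
      ∑ f : ConnFun (Fin n), (ofFun f.1).W.map (Int.castRingHom ℚ) := by
  have key := finsum_classes_eq (X := ConnFun (Fin n)) (Q := LoopClass 1 n) (M := ℚ[X])
    (fun f => Quotient.mk _ (LoopGraph.ofConnFun f))
    (fun f q => Nat.card (Iso (ofFun f.1) q.out.graph)) (fun q => q.out.graph.autCard)
    (2 * n.factorial) (by positivity) ?_ ?_ ?_ (fun q => q.out.graph.W.map (Int.castRingHom ℚ))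
  · refine ⟨key.1, ?_⟩
    rw [loopSeries, PowerSeries.coeff_mk]
    refine Eq.trans key.2 ?_
    congr 1
    refine Finset.sum_congr rfl fun f _ => ?_
    obtain ⟨e⟩ := Quotient.mk_out (s := LoopGraph.isoSetoid 1 n) (LoopGraph.ofConnFun f)
    have := W_of_iso (e.trans (relabelIso (ofFun f.1) (Fintype.equivFin (Fin n × Bool))).symm)
    rw [← this]
  · rintro f q rfl
    obtain ⟨e⟩ := Quotient.mk_out (s := LoopGraph.isoSetoid 1 n) (LoopGraph.ofConnFun f)
    exact card_iso_eq_autCard ((relabelIso (ofFun f.1) _).trans e.symm)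
  · intro f q hq
    have : IsEmpty (Iso (ofFun f.1) q.out.graph) := ⟨fun e => hq <| by
      rw [← Quotient.out_eq q]
      exact Quotient.sound ⟨(relabelIso (ofFun f.1) _).symm.trans e⟩⟩
    exact Nat.card_of_isEmpty
  · intro q
    obtain ⟨f₀, ⟨e⟩⟩ := exists_ofFun_iso q.out.graph q.out.connected q.out.loopNumber_eq
    have hconn : (ofFun f₀).Connected := q.out.connected.of_iso e.symm
    have h := card_sigma_iso ⟨f₀, hconn⟩
    rw [card_orientations, Nat.card_sigma, Fintype.card_fin] at h
    rw [← h]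
    exact Finset.sum_congr rfl fun f _ => (card_iso_congr e).symm

/-! ### Rooted trees -/

namespace Multigraph

section Parent

variable {V : Type*} [Fintype V] [DecidableEq V] {f : V → V} {r : V}

/-- The two graphs differ by a loop at `r`, which gives no black neighbour to a white vertex. -/
theorem blackNbrs_ofParent (hr : f r = r) (c : V → ZMod 2) (v : V) (hv : c v ≠ 1) :
    (ofParent f r).blackNbrs c v = (ofFun f).blackNbrs c v := by
  unfold blackNbrs
  refine Finset.card_bij (fun x _ => (x.1.1, x.2)) ?_ ?_ ?_
  · rintro ⟨u, b⟩
    simp only [Finset.mem_filter, Finset.mem_univ, true_and]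
    cases b <;> exact id
  · rintro ⟨u, b⟩ - ⟨u', b'⟩ - h
    simpa [Subtype.ext_iff] using h
  · rintro ⟨u, b⟩ h
    simp only [Finset.mem_filter, Finset.mem_univ, true_and] at h
    have hu : u ≠ r := by
      rintro rfl
      have hb : ∀ b, (ofFun f).vert (u, b) = u := by rintro (_ | _); exacts [rfl, hr]
      rw [ofFun_opp, hb, hb] at h
      exact hv (h.1 ▸ h.2)
    refine ⟨(⟨u, hu⟩, b), ?_, rfl⟩
    simp only [Finset.mem_filter, Finset.mem_univ, true_and]
    cases b <;> exact h

theorem kind_ofParent (hr : f r = r) (c : V → ZMod 2) (v : V) :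
    (ofParent f r).kind c v = (ofFun f).kind c v := by
  unfold kind
  by_cases hv : c v = 1
  · simp [hv]
  · simp [hv, blackNbrs_ofParent hr c v hv]

theorem admissible_ofParent (hr : f r = r) (c : V → ZMod 2) :
    (ofParent f r).admissible c = (ofFun f).admissible c := by
  unfold admissible
  refine Finset.filter_congr fun v _ => and_congr_right fun hv => ?_
  rw [blackNbrs_ofParent hr c v (by simp [hv])]

end Parent

/-- The part of `W` that comes from the colorings for which `r` is of kind `s`. -/
noncomputable def rootedW {V H : Type*} [Fintype V] [DecidableEq V] [Fintype H]
    (G : Multigraph V H) (r : V) (s : Kind) : ℤ[X] :=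
  ∑ c : V → ZMod 2 with G.kind c r = s, Polynomial.X ^ (G.admissible c).card

theorem rootedW_of_iso {V H V' H' : Type*} [Fintype V] [DecidableEq V] [Fintype H] [Fintype V']
    [DecidableEq V'] [Fintype H'] {G : Multigraph V H} {G' : Multigraph V' H'} {r : V} {r' : V'}
    (e : RootedIso G r G' r') (s : Kind) : G.rootedW r s = G'.rootedW r' s := by
  obtain ⟨e, rfl⟩ := e
  refine (Finset.sum_equiv (e.onVert.arrowCongr (Equiv.refl (ZMod 2))).symm (fun c => ?_)
    fun c _ => ?_).symm
  · simp [← kind_of_iso e]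
    rfl
  · rw [← card_admissible_of_iso e c]
    rfl

theorem rootedW_ofParent {V : Type*} [Fintype V] [DecidableEq V] {f : V → V} {r : V}
    (hr : f r = r) (s : Kind) : (ofParent f r).rootedW r s = (ofFun f).rootedW r s := by
  simp only [rootedW, kind_ofParent hr, admissible_ofParent hr]

end Multigraph

/-- The rooted tree of a parent function. -/
noncomputable def RootedTree.ofTreeFun {n : ℕ} (x : TreeFun (Fin n)) : RootedTree n where
  numHalf := _
  graph := (ofParent x.1.1 x.1.2).relabel (Fintype.equivFin ({v // v ≠ x.1.2} × Bool))
  connected := (ofParent_connected_of_reaches x.2.2).of_iso (relabelIso _ _)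
  loopNumber_eq := ofParent_loopNumber _ (ofParent_connected_of_reaches x.2.2)
  root := x.1.2

theorem RootedTree.partW_eq {n : ℕ} (A : RootedTree n) (s : Kind) :
    A.partW s = A.graph.rootedW A.root s := by
  simp [RootedTree.partW, rootedW]

theorem treeClass_sum (n : ℕ) (s : Kind) : Finite (RootedTreeClass n) ∧
    PowerSeries.coeff n (treeSeries s) = Polynomial.C ((n.factorial : ℚ)⁻¹) *
      ∑ x : TreeFun (Fin n), ((ofFun x.1.1).rootedW x.1.2 s).map (Int.castRingHom ℚ) := by
  have iso₀ : ∀ x : TreeFun (Fin n), RootedIso (ofParent x.1.1 x.1.2) x.1.2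
      (RootedTree.ofTreeFun x).graph (RootedTree.ofTreeFun x).root := fun x =>
    ⟨relabelIso _ _, rfl⟩
  have key := finsum_classes_eq (X := TreeFun (Fin n)) (Q := RootedTreeClass n) (M := ℚ[X])
    (fun x => Quotient.mk _ (RootedTree.ofTreeFun x))
    (fun x q => Nat.card (RootedIso (ofParent x.1.1 x.1.2) x.1.2 q.out.graph q.out.root))
    (fun q => q.out.autCard)
    n.factorial (by positivity) ?_ ?_ ?_ (fun q => (q.out.partW s).map (Int.castRingHom ℚ))
  · refine ⟨key.1, ?_⟩
    rw [treeSeries, PowerSeries.coeff_mk]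
    refine Eq.trans key.2 ?_
    congr 1
    refine Finset.sum_congr rfl fun x _ => ?_
    obtain ⟨e⟩ := Quotient.mk_out (s := RootedTree.isoSetoid n) (RootedTree.ofTreeFun x)
    rw [RootedTree.partW_eq, ← rootedW_ofParent x.2.1, rootedW_of_iso (iso₀ x),
      ← rootedW_of_iso e]
  · rintro x q rfl
    obtain ⟨e⟩ := Quotient.mk_out (s := RootedTree.isoSetoid n) (RootedTree.ofTreeFun x)
    exact (card_rootedIso_congr_left (iso₀ x)).trans (card_rootedIso_congr_left e).symm
  · intro x q hq
    have : IsEmpty (RootedIso (ofParent x.1.1 x.1.2) x.1.2 q.out.graph q.out.root) :=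
      ⟨fun e => hq <| by
        rw [← Quotient.out_eq q]
        exact Quotient.sound ⟨⟨(relabelIso _ _).symm.trans e.1, e.2⟩⟩⟩
    exact Nat.card_of_isEmpty
  · intro q
    obtain ⟨f₀, hr, hf, e, he⟩ := exists_ofParent_iso q.out.graph q.out.connected
      q.out.loopNumber_eq q.out.root
    have h := card_sigma_rootedIso ⟨(f₀, q.out.root), hr, hf⟩
    rw [Nat.card_sigma, Fintype.card_fin] at h
    rw [← h]
    exact Finset.sum_congr rfl fun x _ => (card_rootedIso_congr ⟨e, by rw [he]; rfl⟩).symm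

/-! ### Automorphisms of cycles -/

namespace Multigraph

/-- When `f` is injective, a vertex carries at most two half-edges. -/
theorem eq_of_vert_eq_of_ne {V : Type*} {f : V → V} (hf : Function.Injective f) {x y z : V × Bool}
    (hx : (ofFun f).vert x = (ofFun f).vert z) (hy : (ofFun f).vert y = (ofFun f).vert z)
    (hxz : x ≠ z) (hyz : y ≠ z) : x = y := by
  obtain ⟨x, b⟩ := x
  obtain ⟨y, b'⟩ := y
  obtain ⟨z, b''⟩ := z
  cases b <;> cases b' <;> cases b'' <;>
    simp only [ofFun_vert_false, ofFun_vert_true, ne_eq, Prod.mk.injEq, and_true] at *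
  · exact (hxz hx).elim
  · rw [hx, hy]
  · exact (hxz hx).elim
  · exact (hyz (hf hy)).elim
  · exact (hyz hy).elim
  · exact (hxz (hf hx)).elim
  · exact hf (hx.trans hy.symm)
  · exact (hxz (hf hx)).elim

/-- The image of one half-edge propagates around the cycle: cross the edge, then pass to the other
half-edge at the vertex reached. -/
theorem cycle_iso_ext {n : ℕ}
    {e e' : Iso (ofFun (finRotate (n + 1))) (ofFun (finRotate (n + 1)))}
    (h : e.onHalf (0, false) = e'.onHalf (0, false)) : e = e' := by
  have htrue : ∀ i, e.onHalf (i, false) = e'.onHalf (i, false) →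
      e.onHalf (i, true) = e'.onHalf (i, true) := by
    intro i hi
    have h1 := onHalf_not e i false
    have h2 := onHalf_not e' i false
    rw [hi] at h1
    exact h1.trans h2.symm
  have hfalse : ∀ i, e.onHalf (i, false) = e'.onHalf (i, false) := by
    intro i
    induction i using Fin.induction with
    | zero => exact h
    | succ i ih =>
      have h1 := htrue _ ih
      have key : ∀ e : Iso (ofFun (finRotate (n + 1))) (ofFun (finRotate (n + 1))),
          (ofFun (finRotate (n + 1))).vert (e.onHalf (i.succ, false)) =
            (ofFun (finRotate (n + 1))).vert (e.onHalf (i.castSucc, true)) := by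
        intro e
        rw [e.vert_comm, e.vert_comm]
        simp
      refine eq_of_vert_eq_of_ne (finRotate (n + 1)).injective (key e) ?_ ?_ ?_
      · rw [h1]; exact key e'
      · rw [e.onHalf.injective.ne_iff]; simp
      · rw [h1, e'.onHalf.injective.ne_iff]; simp
  have hhalf : e.onHalf = e'.onHalf := by
    ext1 ⟨i, b⟩
    cases b
    exacts [hfalse i, htrue i (hfalse i)]
  refine Iso.ext ?_ hhalf
  ext1 v
  have h1 := e.vert_comm (v, false)
  rw [hhalf, e'.vert_comm] at h1
  exact h1.symm

/-- The rotations of a cycle. -/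
def cycleRotation {n : ℕ} (i : Fin (n + 1)) : Iso (cycle (n + 1)) (cycle (n + 1)) where
  onVert := Equiv.addRight i
  onHalf := (Equiv.addRight i).prodCongr (Equiv.refl Bool)
  vert_comm := by rintro ⟨v, b⟩; cases b <;> simp [cycle, add_right_comm]
  opp_comm := by rintro ⟨v, b⟩; simp [cycle]

/-- The reflections of a cycle. -/
def cycleReflection {n : ℕ} (i : Fin (n + 1)) : Iso (cycle (n + 1)) (cycle (n + 1)) where
  -- The edge `v` joins `v` to `v + 1`; its image `i - v` joins `i - v` to `i + 1 - v`, hence the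
  -- shift by one between vertices and edges.
  onVert := Equiv.subLeft (i + 1)
  onHalf := (Equiv.subLeft i).prodCongr Equiv.boolNot
  vert_comm := by rintro ⟨v, b⟩; cases b <;> simp [cycle, sub_add_eq_add_sub]
  opp_comm := by rintro ⟨v, b⟩; simp [cycle]

/-- The automorphisms act simply transitively on the half-edges; this includes the loop and the
double edge. -/
theorem autCard_cycle (n : ℕ) : (cycle (n + 1)).autCard = 2 * (n + 1) := by
  have : Function.Bijective
      fun e : Iso (cycle (n + 1)) (cycle (n + 1)) => e.onHalf (0, false) := by
    refine ⟨fun e e' h => cycle_iso_ext h, ?_⟩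
    rintro ⟨i, b⟩
    cases b
    · exact ⟨cycleRotation i, by simp [cycleRotation]⟩
    · exact ⟨cycleReflection i, by simp [cycleReflection]⟩
  rw [autCard, Nat.card_congr (Equiv.ofBijective _ this)]
  simp [mul_comm]

end Multigraph

/-! ### Products of exponential generating functions -/

/-- The sizes of the fibres of `β`. -/
noncomputable def fiberSizes {ι : Type*} {N : ℕ} (β : Fin N → ι) : ι →₀ ℕ :=
  ∑ v, Finsupp.single (β v) 1

theorem fiberSizes_apply {ι : Type*} [DecidableEq ι] {N : ℕ} (β : Fin N → ι) (i : ι) :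
    fiberSizes β i = Fintype.card {v // β v = i} := by
  simp [fiberSizes, Finsupp.finsetSum_apply, Finsupp.single_apply, Fintype.card_subtype]

/-- Both sides are the coefficient of `d` in the `N`-th power of the sum of the variables. -/
theorem card_fiberSizes_eq {ι : Type*} [Fintype ι] [DecidableEq ι] (N : ℕ) (d : ι →₀ ℕ)
    (hd : d.sum (fun _ m => m) = N) :
    (Finset.univ.filter fun β : Fin N → ι => fiberSizes β = d).card = d.multinomial := by
  have h := MvPolynomial.coeff_sum_X_pow_of_fintype (R := ℕ) d N
  rw [if_pos hd, Fintype.sum_pow, MvPolynomial.coeff_sum, Nat.cast_id] at h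
  rw [← h, Finset.card_eq_sum_ones, Finset.sum_filter]
  refine Finset.sum_congr rfl fun β _ => ?_
  have : ∏ v, (MvPolynomial.X (β v) : MvPolynomial ι ℕ) =
      MvPolynomial.monomial (fiberSizes β) 1 := by
    rw [fiberSizes, MvPolynomial.monomial_sum_one]
    rfl
  rw [this, MvPolynomial.coeff_monomial]

theorem coeff_prod_egf {R ι : Type*} [CommRing R] [Algebra ℚ R] [Fintype ι] [DecidableEq ι]
    (E : ι → ℕ → R) (N : ℕ) :
    PowerSeries.coeff N (∏ i, PowerSeries.mk fun k =>
        algebraMap ℚ R ((k.factorial : ℚ)⁻¹) * E i k) =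
      algebraMap ℚ R ((N.factorial : ℚ)⁻¹) *
        ∑ β : Fin N → ι, ∏ i, E i (Fintype.card {v // β v = i}) := by
  have hD : ∀ β ∈ (Finset.univ : Finset (Fin N → ι)),
      fiberSizes β ∈ Finset.finsuppAntidiag Finset.univ N := by
    intro β _
    rw [Finset.mem_finsuppAntidiag]
    refine ⟨?_, Finset.subset_univ _⟩
    simp only [fiberSizes_apply, ← Fintype.card_sigma]
    rw [Fintype.card_congr (Equiv.sigmaFiberEquiv β), Fintype.card_fin]
  rw [PowerSeries.coeff_prod, ← Finset.sum_fiberwise_of_maps_to hD, Finset.mul_sum]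
  refine Finset.sum_congr rfl fun d hd => ?_
  have hcount := card_fiberSizes_eq N d (Finset.mem_finsuppAntidiag'.1 hd).1
  have hsum : ∑ β : Fin N → ι with fiberSizes β = d, ∏ i, E i (Fintype.card {v // β v = i}) =
      algebraMap ℚ R d.multinomial * ∏ i, E i (d i) := by
    rw [← hcount, map_natCast, ← nsmul_eq_mul, ← Finset.sum_const]
    refine Finset.sum_congr rfl fun β hβ => ?_
    simp only [← fiberSizes_apply, (Finset.mem_filter.1 hβ).2]
  rw [hsum, ← mul_assoc, ← map_mul]
  simp only [PowerSeries.coeff_mk, Finset.prod_mul_distrib]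
  rw [← map_prod]
  congr 2
  rw [Finsupp.multinomial_eq_of_support_subset (Finset.subset_univ d.support)]
  have h1 := Nat.multinomial_spec Finset.univ d
  rw [(Finset.mem_finsuppAntidiag.1 hd).1] at h1
  rw [← h1, Finset.prod_inv_distrib]
  push_cast
  have h2 : (Nat.multinomial Finset.univ d : ℚ) ≠ 0 :=
    Nat.cast_ne_zero.2 (Nat.multinomial_pos _ _).ne'
  have h3 : (∏ i, ((d i).factorial : ℚ)) ≠ 0 :=
    Finset.prod_ne_zero_iff.2 fun i _ => Nat.cast_ne_zero.2 (Nat.factorial_ne_zero _)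
  field_simp

/-! ### Connected endofunctions as cyclic sequences of rooted trees -/

section Glue

variable {V : Type*} {n : ℕ} {β : V → Fin (n + 1)} (x : ∀ i, TreeFun {v // β v = i})

/-- The root of the `i`-th tree. -/
def glueRoot (i : Fin (n + 1)) : V := (x i).1.2.1

/-- The parent function of the forest. -/
def glueParent (v : V) : V := ((x (β v)).1.1 ⟨v, rfl⟩).1

open Classical in
/-- The endofunction obtained by joining the roots of the trees to a cycle. -/
noncomputable def glue (v : V) : V :=
  if v = glueRoot x (β v) then glueRoot x (finRotate _ (β v)) else glueParent x v

theorem glueRoot_color (i : Fin (n + 1)) : β (glueRoot x i) = i := (x i).1.2.2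

theorem glueRoot_injective : Function.Injective (glueRoot x) :=
  Function.LeftInverse.injective (glueRoot_color x)

theorem coe_parent {i : Fin (n + 1)} (w : {v // β v = i}) :
    ((x i).1.1 w).1 = glueParent x w.1 := by
  obtain ⟨v, rfl⟩ := w
  rfl

theorem glueParent_color (v : V) : β (glueParent x v) = β v := ((x (β v)).1.1 ⟨v, rfl⟩).2

theorem glueParent_root (i : Fin (n + 1)) : glueParent x (glueRoot x i) = glueRoot x i := by
  rw [glueRoot, ← coe_parent, (x i).2.1]

theorem exists_iterate_glueParent (v : V) : ∃ k, (glueParent x)^[k] v = glueRoot x (β v) := by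
  obtain ⟨k, hk⟩ := (x (β v)).2.2 ⟨v, rfl⟩
  refine ⟨k, ?_⟩
  have : Function.Semiconj Subtype.val (x (β v)).1.1 (glueParent x) := coe_parent x
  rw [glueRoot, ← hk]
  exact ((this.iterate_right k) ⟨v, rfl⟩).symm

theorem iterate_glueParent_color (k : ℕ) (v : V) : β ((glueParent x)^[k] v) = β v := by
  induction k generalizing v with
  | zero => rfl
  | succ k ih => rw [Function.iterate_succ_apply, ih, glueParent_color x]

theorem glue_root (i : Fin (n + 1)) : glue x (glueRoot x i) = glueRoot x (finRotate _ i) := by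
  simp [glue, glueRoot_color]

theorem glue_of_ne {v : V} (hv : v ≠ glueRoot x (β v)) : glue x v = glueParent x v := by
  simp [glue, hv]

theorem iterate_glue_root (k : ℕ) (i : Fin (n + 1)) :
    (glue x)^[k] (glueRoot x i) = glueRoot x ((finRotate _)^[k] i) := by
  have : Function.Semiconj (glueRoot x) (finRotate (n + 1)) (glue x) :=
    fun i => (glue_root x i).symm
  exact ((this.iterate_right k) i).symm

theorem iterate_finRotate (k : ℕ) (i : Fin (n + 1)) :
    (finRotate (n + 1))^[k] i = i + Fin.ofNat (n + 1) k := by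
  induction k with
  | zero => simp
  | succ k ih =>
    rw [Function.iterate_succ_apply', ih, finRotate_apply, add_assoc]
    congr 1
    ext
    simp [Fin.val_add]

theorem reaches_finRotate (i : Fin (n + 1)) : Reaches (finRotate (n + 1)) i := by
  intro j
  refine ⟨(i - j).val, ?_⟩
  rw [iterate_finRotate, Fin.ofNat_val_eq_self, add_sub_cancel]

theorem reaches_glue_root (i : Fin (n + 1)) : Reaches (glue x) (glueRoot x i) := by
  intro v
  obtain ⟨m, hm⟩ := reaches_finRotate i (β v)
  suffices h : ∀ k v, (glueParent x)^[k] v = glueRoot x (β v) →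
      ∃ k, (glue x)^[k] v = glueRoot x (β v) by
    obtain ⟨k, hk⟩ := exists_iterate_glueParent x v
    obtain ⟨k', hk'⟩ := h k v hk
    exact ⟨m + k', by rw [Function.iterate_add_apply, hk', iterate_glue_root, hm]⟩
  clear hm v
  intro k
  induction k with
  | zero => intro v hv; exact ⟨0, hv⟩
  | succ k ih =>
    intro v hv
    by_cases hr : v = glueRoot x (β v)
    · exact ⟨0, hr⟩
    · rw [Function.iterate_succ_apply, ← glueParent_color x] at hv
      obtain ⟨k', hk'⟩ := ih _ hv
      refine ⟨k' + 1, ?_⟩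
      rw [Function.iterate_succ_apply, glue_of_ne x hr, hk', glueParent_color x]

theorem reaches_glue_iff (q : V) : Reaches (glue x) q ↔ q ∈ Set.range (glueRoot x) := by
  constructor
  · intro h
    obtain ⟨k, hk⟩ := h (glueRoot x 0)
    rw [iterate_glue_root] at hk
    exact ⟨_, hk⟩
  · rintro ⟨i, rfl⟩
    exact reaches_glue_root x i

theorem card_reaches_glue : Nat.card {q // Reaches (glue x) q} = n + 1 := by
  have : {q | Reaches (glue x) q} = Set.range (glueRoot x) := Set.ext (reaches_glue_iff x)
  change Nat.card ↥{q | Reaches (glue x) q} = n + 1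
  rw [this, Nat.card_range_of_injective (glueRoot_injective x), Nat.card_fin]

end Glue

/-- Endofunctions with a base point on their only cycle, which has length `m`. -/
abbrev PointedFun (V : Type*) (m : ℕ) :=
  {y : (V → V) × V // Reaches y.1 y.2 ∧ Nat.card {q // Reaches y.1 q} = m}

noncomputable instance (V : Type*) [Finite V] (m : ℕ) : Fintype (PointedFun V m) :=
  Fintype.ofFinite _

/-- Join a cyclic sequence of rooted trees. -/
noncomputable def gluePointed {V : Type*} {n : ℕ}
    (z : Σ β : V → Fin (n + 1), ∀ i, TreeFun {v // β v = i}) : PointedFun V (n + 1) :=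
  ⟨(glue z.2, glueRoot z.2 0), reaches_glue_root z.2 0, card_reaches_glue z.2⟩

/-- The iterates of the base point give the roots in order, the function off the roots gives the
parents, and the root reached from `v` gives `β v`. -/
theorem gluePointed_injective {V : Type*} {n : ℕ} :
    Function.Injective (gluePointed (V := V) (n := n)) := by
  rintro ⟨β, x⟩ ⟨β', x'⟩ h
  simp only [gluePointed, Subtype.mk.injEq, Prod.mk.injEq] at h
  obtain ⟨hglue, hroot⟩ := h
  have hr : ∀ i, glueRoot x i = glueRoot x' i := by
    intro i
    obtain ⟨k, hk⟩ := reaches_finRotate i 0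
    rw [← hk, ← iterate_glue_root, ← iterate_glue_root, hglue, hroot]
  have hmem : ∀ {β : V → Fin (n + 1)} (x : ∀ i, TreeFun {v // β v = i}) (v : V),
      (∃ i, v = glueRoot x i) ↔ v = glueRoot x (β v) := by
    refine fun x v => ⟨?_, fun h => ⟨_, h⟩⟩
    rintro ⟨i, rfl⟩
    rw [glueRoot_color x]
  have hp : ∀ v, glueParent x v = glueParent x' v := by
    intro v
    by_cases hv : ∃ i, v = glueRoot x i
    · obtain ⟨i, rfl⟩ := hv
      rw [glueParent_root, hr, glueParent_root]
    · have hv' : ¬ ∃ i, v = glueRoot x' i := by simpa only [hr] using hv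
      rw [← glue_of_ne x (fun h => hv ((hmem x v).2 h)), hglue,
        glue_of_ne x' (fun h => hv' ((hmem x' v).2 h))]
  have hβ : β = β' := by
    funext v
    obtain ⟨k, hk⟩ := exists_iterate_glueParent x' v
    rw [← iterate_glueParent_color x k v, funext hp, hk, ← hr, glueRoot_color x]
  subst hβ
  have hx : x = x' := by
    funext i
    refine Subtype.ext (Prod.ext ?_ (Subtype.ext (hr i)))
    funext w
    exact Subtype.ext (by rw [coe_parent, coe_parent, hp])
  rw [hx]

theorem gluePointed_surjective {V : Type*} {n : ℕ} :
    Function.Surjective (gluePointed (V := V) (n := n)) := by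
  classical
  rintro ⟨⟨f, p⟩, hp, hcard⟩
  dsimp only at hp hcard
  have hmin : 0 < Function.minimalPeriod f p := by
    obtain ⟨k, hk⟩ := hp (f p)
    exact Function.IsPeriodicPt.minimalPeriod_pos k.succ_pos hk
  have hmem : ∀ q, Reaches f q ↔ ∃ i : Fin (Function.minimalPeriod f p), f^[i] p = q := by
    refine fun q => ⟨fun h => ?_, fun ⟨i, hi⟩ => hp.of_iterate hi⟩
    obtain ⟨k, hk⟩ := h p
    exact ⟨⟨k % _, Nat.mod_lt _ hmin⟩, by rw [← hk, Function.iterate_mod_minimalPeriod_eq]⟩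
  have hinj : Function.Injective fun i : Fin (Function.minimalPeriod f p) => f^[i] p :=
    fun i j h => Fin.ext ((Function.iterate_eq_iterate_iff_of_lt_minimalPeriod i.2 j.2).1 h)
  have hper : Function.minimalPeriod f p = n + 1 := by
    have hset : {q | Reaches f q} =
        Set.range fun i : Fin (Function.minimalPeriod f p) => f^[i] p := Set.ext hmem
    rw [← hcard]
    change _ = Nat.card ↥{q | Reaches f q}
    rw [hset, Nat.card_range_of_injective hinj, Nat.card_fin]
  let r : Fin (n + 1) → V := fun i => f^[i] p
  rw [hper] at hmem hinj
  have hfr : ∀ i, f (r i) = r (finRotate _ i) := by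
    intro i
    simp only [r]
    have hval : (finRotate (n + 1) i).val = (i.val + 1) % (n + 1) := by
      rw [finRotate_apply]
      simp [Fin.val_add]
    have hmod := Function.iterate_mod_minimalPeriod_eq (f := f) (x := p) (n := i.val + 1)
    rw [hper] at hmod
    rw [hval, hmod, Function.iterate_succ_apply']
  -- `f` stopped at the cycle: the parent function of the forest left when the cycle is cut.
  let h : V → V := fun v => if Reaches f v then v else f v
  have hfix : ∀ i, h (r i) = r i := fun i => if_pos ((hmem _).2 ⟨i, rfl⟩)
  have hex : ∀ v, ∃ i, ∃ k, h^[k] v = r i := by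
    intro v
    obtain ⟨k, hk⟩ := hp v
    induction k generalizing v with
    | zero => exact ⟨0, 0, hk⟩
    | succ k ih =>
      by_cases hv : Reaches f v
      · obtain ⟨i, hi⟩ := (hmem v).1 hv
        exact ⟨i, 0, hi.symm⟩
      · obtain ⟨i, k', hk'⟩ := ih (f v) hk
        refine ⟨i, k' + 1, ?_⟩
        rw [Function.iterate_succ_apply, show h v = f v from if_neg hv, hk']
  -- Both values are fixed by `h`, so they agree with the iterate of order `k + l`.
  have huniq : ∀ v i j k l, h^[k] v = r i → h^[l] v = r j → i = j := by
    intro v i j k l hk hl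
    apply hinj
    change r i = r j
    rw [← Function.iterate_fixed (hfix i) l, ← hk, ← Function.iterate_add_apply, add_comm,
      Function.iterate_add_apply, hl, Function.iterate_fixed (hfix j)]
  choose β hβ using hex
  have hβr : ∀ i, β (r i) = i := by
    intro i
    obtain ⟨k, hk⟩ := hβ (r i)
    exact huniq _ _ _ _ _ hk (show h^[0] (r i) = r i from rfl)
  have hβh : ∀ v, β (h v) = β v := by
    intro v
    obtain ⟨k, hk⟩ := hβ (h v)
    obtain ⟨l, hl⟩ := hβ v
    exact huniq v _ _ (k + 1) l hk hl
  have hreach : ∀ i, Reaches (fun w : {v // β v = i} => (⟨h w, (hβh w).trans w.2⟩ : {v // β v = i}))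
      ⟨r i, hβr i⟩ := by
    rintro i ⟨v, rfl⟩
    obtain ⟨k, hk⟩ := hβ v
    refine ⟨k, Subtype.ext ?_⟩
    have hs : Function.Semiconj Subtype.val
      (fun w : {u // β u = β v} => (⟨h w, (hβh w).trans w.2⟩ : {u // β u = β v})) h := fun _ => rfl
    rw [(hs.iterate_right k) ⟨v, rfl⟩, hk]
  let x : ∀ i, TreeFun {v // β v = i} := fun i =>
    ⟨(fun w => ⟨h w, (hβh w).trans w.2⟩, ⟨r i, hβr i⟩), Subtype.ext (hfix i), hreach i⟩
  refine ⟨⟨β, x⟩, Subtype.ext (Prod.ext (funext fun v => ?_) rfl)⟩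
  change glue x v = f v
  by_cases hv : v = r (β v)
  · have : glue x v = r (finRotate _ (β v)) := if_pos hv
    rw [this, ← hfr, ← hv]
  · rw [glue_of_ne x hv]
    refine if_neg fun hv' => hv ?_
    obtain ⟨i, hi⟩ := (hmem v).1 hv'
    replace hi : r i = v := hi
    rw [← hi, hβr]

/-! ### Colorings of functional graphs -/

theorem blackNbrs_ofFun {V : Type*} [Fintype V] [DecidableEq V] (f : V → V) (c : V → ZMod 2)
    (v : V) : (ofFun f).blackNbrs c v =
      (Finset.univ.filter fun u => f u = v ∧ c u = 1).card + if c (f v) = 1 then 1 else 0 := by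
  have h2 : ∑ u, (if u = v ∧ c (f u) = 1 then 1 else 0) = if c (f v) = 1 then 1 else 0 := by
    simp only [ite_and]
    exact Fintype.sum_ite_eq' v _
  rw [blackNbrs, Finset.card_filter, Finset.card_filter, Fintype.sum_prod_type, ← h2,
    ← Finset.sum_add_distrib]
  refine Finset.sum_congr rfl fun u _ => ?_
  rw [Fintype.sum_bool]
  rfl

section Glue

variable {V : Type*} [Fintype V] [DecidableEq V] {n : ℕ} {β : V → Fin (n + 1)}
  (x : ∀ i, TreeFun {v // β v = i})

/-- A root is its own parent, so it could only be counted if `w` were that root and black. -/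
theorem card_fiber_black (c : V → ZMod 2) {i : Fin (n + 1)} (w : {v // β v = i}) (hw : c w ≠ 1) :
    (Finset.univ.filter fun u : {v // β v = i} => (x i).1.1 u = w ∧ c u = 1).card =
      (Finset.univ.filter fun u : V =>
        (glueParent x u = w ∧ c u = 1) ∧ u ≠ glueRoot x (β u)).card := by
  refine Finset.card_bij (fun u _ => u.1) ?_ (fun _ _ _ _ h => Subtype.ext h) ?_
  · intro u hu
    simp only [Finset.mem_filter, Finset.mem_univ, true_and] at hu ⊢
    rw [← coe_parent, hu.1]
    refine ⟨⟨rfl, hu.2⟩, fun h => hw ?_⟩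
    rw [← hu.1, coe_parent, h, glueParent_root, ← h, hu.2]
  · intro u hu
    simp only [Finset.mem_filter, Finset.mem_univ, true_and] at hu
    have hi : β u = i := by rw [← glueParent_color x, hu.1.1, w.2]
    refine ⟨⟨u, hi⟩, ?_, rfl⟩
    simp only [Finset.mem_filter, Finset.mem_univ, true_and]
    exact ⟨Subtype.ext (by rw [coe_parent, hu.1.1]), hu.1.2⟩

theorem card_glue_black (c : V → ZMod 2) (v : V) :
    (Finset.univ.filter fun u : V => glue x u = v ∧ c u = 1).card =
      (Finset.univ.filter fun u : V =>
        (glueParent x u = v ∧ c u = 1) ∧ u ≠ glueRoot x (β u)).card +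
      (Finset.univ.filter fun j : Fin (n + 1) =>
        glueRoot x (finRotate _ j) = v ∧ c (glueRoot x j) = 1).card := by
  rw [add_comm, ← Finset.card_filter_add_card_filter_not (fun u => u = glueRoot x (β u))]
  congr 1
  · refine (Finset.card_bij (fun j _ => glueRoot x j) ?_
      (fun _ _ _ _ h => glueRoot_injective x h) ?_).symm
    · intro j hj
      simp only [Finset.mem_filter, Finset.mem_univ, true_and] at hj ⊢
      rw [glue_root, glueRoot_color x]
      exact ⟨hj, rfl⟩
    · intro u hu
      simp only [Finset.mem_filter, Finset.mem_univ, true_and] at hu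
      refine ⟨β u, ?_, hu.2.symm⟩
      simp only [Finset.mem_filter, Finset.mem_univ, true_and]
      rw [← glue_root, ← hu.2]
      exact hu.1
  · rw [Finset.filter_filter]
    congr 1
    ext u
    simp only [Finset.mem_filter, Finset.mem_univ, true_and]
    refine and_congr_left fun hu => ?_
    rw [glue_of_ne x hu]

/-- Black neighbours in a joined graph: those in the tree and, at a root, those on the cycle. -/
theorem blackNbrs_glue (c : V → ZMod 2) {i : Fin (n + 1)} (w : {v // β v = i}) (hw : c w ≠ 1) :
    (ofFun (glue x)).blackNbrs c w = (ofFun (x i).1.1).blackNbrs (fun u => c u) w +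
      if w = (x i).1.2 then (ofFun (finRotate (n + 1))).blackNbrs (fun j => c (glueRoot x j)) i
      else 0 := by
  have hwi : ∀ j, glueRoot x j = w → j = i := fun j hj => by rw [← glueRoot_color x j, hj, w.2]
  rw [blackNbrs_ofFun, blackNbrs_ofFun, card_glue_black, card_fiber_black x c w hw]
  by_cases hr : w = (x i).1.2
  · have hr' : w.1 = glueRoot x i := congrArg Subtype.val hr
    rw [if_pos hr, blackNbrs_ofFun]
    have h1 : c ((x i).1.1 w) ≠ 1 := by rwa [coe_parent, hr', glueParent_root, ← hr']
    rw [if_neg h1, hr', glue_root]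
    simp only [(glueRoot_injective x).eq_iff]
    omega
  · have hr' : w.1 ≠ glueRoot x (β w) := by
      rw [w.2]
      exact fun h => hr (Subtype.ext h)
    have hz : (Finset.univ.filter fun j : Fin (n + 1) =>
        glueRoot x (finRotate _ j) = w ∧ c (glueRoot x j) = 1).card = 0 := by
      rw [Finset.card_eq_zero, Finset.filter_eq_empty_iff]
      rintro j - ⟨h1, -⟩
      apply hr'
      rw [w.2]
      exact h1.symm.trans (congrArg _ (hwi _ h1))
    rw [if_neg hr, glue_of_ne x hr', coe_parent, hz, add_zero, add_zero]

end Glue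

/-! ### Weighted sums over colored rooted trees -/

section Weights

variable {R : Type*} [CommRing R] (t : R)

/-- The weight of a coloring of a rooted tree whose root has `ε` additional black neighbours. -/
def treeWeight {V : Type*} [Fintype V] [DecidableEq V] (ε : ℕ) (f : V → V) (r : V)
    (c : V → ZMod 2) : R :=
  ∏ v, if c v = 0 ∧ Even ((ofFun f).blackNbrs c v + if v = r then ε else 0) then t else 1

/-- The weighted sum over the colored rooted trees on `V` whose root has color `a` and `ε`
additional black neighbours. -/
noncomputable def treeSum (a : ZMod 2) (ε : ℕ) (V : Type*) [Fintype V] [DecidableEq V] : R :=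
  ∑ x : TreeFun V, ∑ c : V → ZMod 2, if c x.1.2 = a then treeWeight t ε x.1.1 x.1.2 c else 0

theorem pow_card_admissible {V H : Type*} [Fintype V] [DecidableEq V] [Fintype H]
    (G : Multigraph V H) (c : V → ZMod 2) :
    t ^ (G.admissible c).card = ∏ v, if c v = 0 ∧ Even (G.blackNbrs c v) then t else 1 := by
  rw [← Finset.prod_const, admissible, Finset.prod_filter]

theorem prod_treeWeight {V : Type*} [Fintype V] [DecidableEq V] {n : ℕ} {β : V → Fin (n + 1)}
    (x : ∀ i, TreeFun {v // β v = i}) (c : V → ZMod 2) :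
    ∏ i, treeWeight t ((ofFun (finRotate (n + 1))).blackNbrs (fun j => c (glueRoot x j)) i)
      (x i).1.1 (x i).1.2 (fun u => c u) = t ^ ((ofFun (glue x)).admissible c).card := by
  rw [pow_card_admissible, ← Fintype.prod_fiberwise β]
  refine Finset.prod_congr rfl fun i _ => Finset.prod_congr rfl fun w _ => ?_
  refine if_congr (and_congr_right fun hw => ?_) rfl rfl
  rw [blackNbrs_glue x c w (by simp [hw])]

/-- Transport of rooted trees along a bijection. -/
def treeFunCongr {V V' : Type*} (e : V ≃ V') : TreeFun V ≃ TreeFun V' :=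
  ((e.arrowCongr e).prodCongr e).subtypeEquiv fun x => by
    obtain ⟨f, r⟩ := x
    have hs : Function.Semiconj e f (e.arrowCongr e f) := fun v => by simp
    simp only [Equiv.prodCongr_apply, Prod.map, Equiv.arrowCongr_apply, Function.comp_apply,
      Equiv.symm_apply_apply, e.injective.eq_iff]
    refine and_congr_right fun _ => ⟨fun h v => ?_, fun h v => ?_⟩
    · obtain ⟨k, hk⟩ := h (e.symm v)
      refine ⟨k, ?_⟩
      rw [← hk, hs.iterate_right k, Equiv.apply_symm_apply]
    · obtain ⟨k, hk⟩ := h (e v)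
      refine ⟨k, e.injective ?_⟩
      rw [hs.iterate_right k, ← hk]

theorem treeSum_congr {V V' : Type*} [Fintype V] [DecidableEq V] [Fintype V'] [DecidableEq V']
    (e : V ≃ V') (a : ZMod 2) (ε : ℕ) : treeSum t a ε V = treeSum t a ε V' := by
  refine Fintype.sum_equiv (treeFunCongr e) _ _ fun x => ?_
  refine Fintype.sum_equiv (e.arrowCongr (Equiv.refl _)) _ _ fun c => ?_
  obtain ⟨⟨f, r⟩, hx⟩ := x
  refine if_congr (by simp [treeFunCongr]) ?_ rfl
  refine Fintype.prod_equiv e _ _ fun v => ?_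
  refine if_congr (and_congr (by simp) ?_) rfl rfl
  have hb : (ofFun (e.arrowCongr e f)).blackNbrs (e.arrowCongr (Equiv.refl _) c) (e v) =
      (ofFun f).blackNbrs c v := by
    rw [blackNbrs_ofFun, blackNbrs_ofFun]
    congr 1
    · refine (Finset.card_equiv e fun u => ?_).symm
      simp
    · simp
  simp only [treeFunCongr, Equiv.subtypeEquiv_apply, Equiv.prodCongr_apply, Prod.map,
    e.injective.eq_iff]
  rw [hb]

/-- The colorings of `V` correspond to the families of colorings of the fibres of `β`. -/
def fiberColorings {V ι A : Type*} (β : V → ι) : (V → A) ≃ ∀ i, {v // β v = i} → A where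
  toFun c i u := c u
  invFun c v := c (β v) ⟨v, rfl⟩
  left_inv c := rfl
  right_inv c := by
    funext i ⟨v, hv⟩
    subst hv
    rfl

/-- A coloring of the joined graph is a family of tree colorings whose root colors agree with a
coloring of the cycle; its weight is the product of the tree weights by `prod_treeWeight`. -/
theorem sum_prod_treeSum {V : Type*} [Fintype V] [DecidableEq V] (n : ℕ) :
    ∑ a : Fin (n + 1) → ZMod 2, ∑ β : V → Fin (n + 1),
      ∏ i, treeSum t (a i) ((ofFun (finRotate (n + 1))).blackNbrs a i) {v // β v = i} =
    ∑ y : PointedFun V (n + 1), ∑ c : V → ZMod 2, t ^ ((ofFun y.1.1).admissible c).card := by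
  classical
  rw [← Fintype.sum_bijective (gluePointed (V := V) (n := n))
    ⟨gluePointed_injective, gluePointed_surjective⟩ _ _ fun z => rfl, Fintype.sum_sigma,
    Finset.sum_comm]
  refine Finset.sum_congr rfl fun β _ => ?_
  simp only [treeSum, Finset.prod_univ_sum, Fintype.piFinset_univ]
  rw [Finset.sum_comm]
  refine Finset.sum_congr rfl fun x _ => ?_
  rw [Finset.sum_comm, ← (fiberColorings (A := ZMod 2) β).sum_comp]
  refine Finset.sum_congr rfl fun c _ => ?_
  simp only [gluePointed]
  -- Only the cycle coloring read off from the roots survives.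
  rw [← prod_treeWeight t x c, Finset.sum_eq_single fun i => c (glueRoot x i)]
  · exact Finset.prod_congr rfl fun i _ => if_pos rfl
  · intro a _ ha
    obtain ⟨i, hi⟩ := Function.ne_iff.1 ha
    exact Finset.prod_eq_zero (Finset.mem_univ i) (if_neg (Ne.symm hi))
  · simp

end Weights

instance : Fintype Kind := ⟨{.b, .wPlus, .wMinus}, by rintro (_ | _ | _) <;> simp⟩

/-! ### Coefficients of the substituted series -/

/-- The kind of a vertex of color `a` with `m` black neighbours. -/
def kindOf (a : ZMod 2) (m : ℕ) : Kind :=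
  if a = 1 then .b else if Even m then .wPlus else .wMinus

section TreeWeights

variable {R : Type*} [CommRing R] (t : R) {V : Type*} [Fintype V] [DecidableEq V]

theorem treeWeight_eq_mul (ε : ℕ) (f : V → V) (r : V) (c : V → ZMod 2) :
    treeWeight t ε f r c = (if c r = 0 ∧ Even ((ofFun f).blackNbrs c r + ε) then t else 1) *
      ∏ v ∈ Finset.univ.erase r,
        if c v = 0 ∧ Even ((ofFun f).blackNbrs c v) then t else 1 := by
  rw [treeWeight, ← Finset.mul_prod_erase _ _ (Finset.mem_univ r), if_pos rfl]
  congr 1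
  refine Finset.prod_congr rfl fun v hv => ?_
  rw [if_neg (Finset.ne_of_mem_erase hv), add_zero]

theorem pow_card_admissible_eq_mul (f : V → V) (r : V) (c : V → ZMod 2) :
    t ^ ((ofFun f).admissible c).card =
      (if c r = 0 ∧ Even ((ofFun f).blackNbrs c r) then t else 1) *
      ∏ v ∈ Finset.univ.erase r,
        if c v = 0 ∧ Even ((ofFun f).blackNbrs c v) then t else 1 := by
  rw [pow_card_admissible, ← Finset.mul_prod_erase _ _ (Finset.mem_univ r)]

/-- The contribution of a colored rooted tree with root of kind `s` to the tree series. -/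
def kindWeight (s : Kind) (f : V → V) (r : V) (c : V → ZMod 2) : R :=
  if (ofFun f).kind c r = s then t ^ ((ofFun f).admissible c).card else 0

/-- The contribution of a colored rooted tree to the series substituted for `s`. -/
def graftWeight (t' : R) (f : V → V) (r : V) (c : V → ZMod 2) : Kind → R
  | .b => kindWeight t .b f r c
  | .wPlus => kindWeight t .wPlus f r c + kindWeight t .wMinus f r c
  | .wMinus => t' * kindWeight t .wPlus f r c + t * kindWeight t .wMinus f r c

/-- Only the parity of `m` matters. For a white root and odd `m` the factor `t` of an even root is
cancelled by `t'`, and an odd root acquires it. -/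
theorem graftWeight_kindOf {t' : R} (ht : t' * t = 1) (f : V → V) (r : V) (c : V → ZMod 2)
    (a : ZMod 2) (m : ℕ) : graftWeight t t' f r c (kindOf a m) =
      if c r = a then treeWeight t m f r c else 0 := by
  have hz : ∀ z : ZMod 2, z = 0 ∨ z = 1 := by decide
  rw [treeWeight_eq_mul]
  have h01 : (0 : ZMod 2) ≠ 1 := by decide
  rcases hz a with rfl | rfl <;> rcases hz (c r) with hc | hc <;>
    by_cases hm : Even m <;> by_cases hn : Even ((ofFun f).blackNbrs c r) <;>
    simp [kindOf, graftWeight, kindWeight, kind, hc, hm, hn, h01, pow_card_admissible_eq_mul t f r,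
      Nat.even_add, ← mul_assoc, ht]

end TreeWeights

theorem coeff_toLaurentSeries_treeSeries (k : ℕ) (s : Kind) :
    PowerSeries.coeff k (toLaurentSeries (treeSeries s)) =
      algebraMap ℚ ℚ[T;T⁻¹] ((k.factorial : ℚ)⁻¹) * ∑ x : TreeFun (Fin k),
        ∑ c : Fin k → ZMod 2, kindWeight (LaurentPolynomial.T 1) s x.1.1 x.1.2 c := by
  rw [toLaurentSeries, PowerSeries.coeff_map, (treeClass_sum k s).2]
  simp only [rootedW, map_mul, map_sum, Polynomial.map_sum, Polynomial.map_pow, Polynomial.map_X,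
    Polynomial.toLaurent_X, map_pow, kindWeight, ← Finset.sum_filter, Polynomial.toLaurent_C]
  rfl

theorem coeff_graft (k : ℕ) (a : ZMod 2) (m : ℕ) :
    PowerSeries.coeff k (graft (kindOf a m)) = algebraMap ℚ ℚ[T;T⁻¹] ((k.factorial : ℚ)⁻¹) *
      treeSum (LaurentPolynomial.T 1) a m (Fin k) := by
  have ht : (LaurentPolynomial.T (-1) : ℚ[T;T⁻¹]) * LaurentPolynomial.T 1 = 1 := by
    rw [← LaurentPolynomial.T_add]
    simp
  have h : ∀ s, PowerSeries.coeff k (graft s) = algebraMap ℚ ℚ[T;T⁻¹] ((k.factorial : ℚ)⁻¹) *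
      ∑ x : TreeFun (Fin k), ∑ c : Fin k → ZMod 2,
        graftWeight (LaurentPolynomial.T 1) (LaurentPolynomial.T (-1)) x.1.1 x.1.2 c s := by
    rintro (_ | _ | _)
    · simp only [graft, graftWeight, coeff_toLaurentSeries_treeSeries]
    · simp only [graft, graftWeight, coeff_toLaurentSeries_treeSeries, map_add,
        Finset.sum_add_distrib, mul_add]
    · simp only [graft, graftWeight, coeff_toLaurentSeries_treeSeries, map_add,
        PowerSeries.coeff_C_mul, Finset.sum_add_distrib, mul_add, ← Finset.mul_sum]
      ring
  rw [h]
  simp only [graftWeight_kindOf _ ht]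
  rfl

theorem kind_eq_kindOf {V H : Type*} [DecidableEq V] [Fintype H] (G : Multigraph V H)
    (c : V → ZMod 2) (v : V) : G.kind c v = kindOf (c v) (G.blackNbrs c v) := rfl

theorem exists_kindOf_eq (s : Kind) : ∃ a m, kindOf a m = s := by
  cases s
  exacts [⟨1, 0, rfl⟩, ⟨0, 0, rfl⟩, ⟨0, 1, by decide⟩]

theorem coeff_zero_graft (s : Kind) : PowerSeries.coeff 0 (graft s) = 0 := by
  obtain ⟨a, m, rfl⟩ := exists_kindOf_eq s
  rw [coeff_graft, treeSum]
  have : IsEmpty (TreeFun (Fin 0)) := ⟨fun x => x.1.2.elim0⟩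
  simp

theorem hasSubst_graft : MvPowerSeries.HasSubst graft :=
  MvPowerSeries.hasSubst_of_constantCoeff_zero fun s => by
    have := coeff_zero_graft s
    rwa [PowerSeries.coeff_zero_eq_constantCoeff_apply] at this

theorem sum_coeff_prod_graft (N n : ℕ) :
    ∑ a : Fin (n + 1) → ZMod 2,
      PowerSeries.coeff N (∏ i, graft ((cycle (n + 1)).kind a i)) =
    algebraMap ℚ ℚ[T;T⁻¹] ((N.factorial : ℚ)⁻¹) *
      ∑ y : PointedFun (Fin N) (n + 1), ∑ c : Fin N → ZMod 2,
        LaurentPolynomial.T 1 ^ ((ofFun y.1.1).admissible c).card := by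
  have h : ∀ (a : ZMod 2) (m : ℕ), graft (kindOf a m) = PowerSeries.mk fun k =>
      algebraMap ℚ ℚ[T;T⁻¹] ((k.factorial : ℚ)⁻¹) *
        treeSum (LaurentPolynomial.T 1) a m (Fin k) := by
    intro a m
    ext1 k
    rw [coeff_graft, PowerSeries.coeff_mk]
  simp only [kind_eq_kindOf, h]
  rw [← sum_prod_treeSum, Finset.mul_sum]
  refine Finset.sum_congr rfl fun a _ => ?_
  rw [coeff_prod_egf (fun i k => treeSum (LaurentPolynomial.T 1 : ℚ[T;T⁻¹]) (a i)
    ((cycle (n + 1)).blackNbrs a i) (Fin k))]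
  congr 1
  refine Finset.sum_congr rfl fun β _ => Finset.prod_congr rfl fun i _ => ?_
  exact (treeSum_congr _ (Fintype.equivFin _) _ _).symm

/-! ### Forgetting the base point -/

/-- A connected endofunction with a cycle of length `m` has `m` possible base points, and `m` is
between 1 and |V|. -/
theorem sum_pointedFun {R : Type*} [CommRing R] [Algebra ℚ R] {V : Type*} [Fintype V]
    (F : (V → V) → R) :
    ∑ n ∈ Finset.range (Fintype.card V), algebraMap ℚ R (((n + 1 : ℕ) : ℚ)⁻¹) *
      ∑ y : PointedFun V (n + 1), F y.1.1 = ∑ f : ConnFun V, F f.1 := by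
  classical
  have h1 : ∀ m, ∑ y : PointedFun V m, F y.1.1 = ∑ f : V → V, ∑ p : V,
      if Reaches f p ∧ Nat.card {q // Reaches f q} = m then F f else 0 := by
    intro m
    rw [← Finset.sum_subtype (Finset.univ.filter fun y : (V → V) × V =>
      Reaches y.1 y.2 ∧ Nat.card {q // Reaches y.1 q} = m) (by simp) fun y => F y.1,
      Finset.sum_filter, Fintype.sum_prod_type]
  rw [← Finset.sum_subtype (Finset.univ.filter fun f : V → V => (ofFun f).Connected) (by simp) F,
    Finset.sum_filter]
  simp only [h1, Finset.mul_sum]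
  rw [Finset.sum_comm]
  refine Finset.sum_congr rfl fun f _ => ?_
  have hcard : Nat.card {q // Reaches f q} = (Finset.univ.filter fun p => Reaches f p).card := by
    rw [Nat.card_eq_fintype_card, Fintype.card_subtype]
  by_cases hf : (ofFun f).Connected
  · rw [if_pos hf, Finset.sum_comm]
    obtain ⟨p₀, hp₀⟩ := exists_reaches_of_connected hf
    obtain ⟨m, hm⟩ : ∃ m, Nat.card {q // Reaches f q} = m + 1 := by
      rw [hcard]
      exact Nat.exists_eq_succ_of_ne_zero
        (Finset.card_ne_zero_of_mem (Finset.mem_filter.2 ⟨Finset.mem_univ p₀, hp₀⟩))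
    have hmV : m ∈ Finset.range (Fintype.card V) := by
      rw [Finset.mem_range, ← Nat.succ_le_iff, Nat.succ_eq_add_one, ← hm, hcard]
      exact Finset.card_le_univ _
    have h2 : ∀ p, ∑ n ∈ Finset.range (Fintype.card V), algebraMap ℚ R (((n + 1 : ℕ) : ℚ)⁻¹) *
        (if Reaches f p ∧ Nat.card {q // Reaches f q} = n + 1 then F f else 0) =
        if Reaches f p then algebraMap ℚ R (((m + 1 : ℕ) : ℚ)⁻¹) * F f else 0 := by
      intro p
      rw [Finset.sum_eq_single_of_mem m hmV]
      · by_cases hp : Reaches f p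
        · rw [if_pos ⟨hp, hm⟩, if_pos hp]
        · rw [if_neg fun h => hp h.1, if_neg hp, mul_zero]
      · intro n _ hn
        rw [if_neg, mul_zero]
        rintro ⟨-, h⟩
        omega
    rw [Finset.sum_congr rfl fun p _ => h2 p, ← Finset.sum_filter, Finset.sum_const, ← hcard, hm,
      nsmul_eq_mul, ← mul_assoc, ← map_natCast (algebraMap ℚ R), ← map_mul, mul_inv_cancel₀,
      map_one, one_mul]
    exact Nat.cast_ne_zero.2 m.succ_ne_zero
  · rw [if_neg hf]
    refine Finset.sum_eq_zero fun n _ => Finset.sum_eq_zero fun p _ => ?_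
    rw [if_neg, mul_zero]
    exact fun h => hf (ofFun_connected_of_reaches h.1)

/-! ### The substitution -/

theorem fullW_isHomogeneous {V H : Type*} [Fintype V] [DecidableEq V] [Fintype H]
    (G : Multigraph V H) : G.fullW.IsHomogeneous (Fintype.card V) := by
  refine MvPolynomial.IsHomogeneous.sum _ _ _ fun c _ => ?_
  have := MvPolynomial.IsHomogeneous.prod Finset.univ
    (fun v => (MvPolynomial.X (G.kind c v) : MvPolynomial Kind ℤ)) (fun _ => 1)
    fun v _ => MvPolynomial.isHomogeneous_X _ _
  simpa using this

theorem degree_eq_of_coeff_cycle_ne_zero {d : Kind →₀ ℕ} {n : ℕ}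
    (h : (cycle (n + 1)).fullW.coeff d ≠ 0) : d.degree = n + 1 := by
  by_contra hne
  exact h ((fullW_isHomogeneous (cycle (n + 1))).coeff_eq_zero (by simpa using hne))

/-- The part of `cycleSeries` of degree at most `N`. -/
noncomputable def truncCycle (N : ℕ) : MvPolynomial Kind ℚ :=
  ∑ n ∈ Finset.range N, MvPolynomial.C (((cycle (n + 1)).autCard : ℚ)⁻¹) *
    (cycle (n + 1)).fullW.map (Int.castRingHom ℚ)

theorem coeff_cycleSeries {N : ℕ} {d : Kind →₀ ℕ} (hd : d.degree ≤ N) :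
    MvPowerSeries.coeff d cycleSeries = (truncCycle N).coeff d := by
  rw [truncCycle, MvPolynomial.coeff_sum]
  change ∑ᶠ n : ℕ, _ = _
  rw [finsum_eq_sum_of_support_subset (s := Finset.range N)]
  · refine Finset.sum_congr rfl fun n _ => ?_
    rw [MvPolynomial.coeff_C_mul, MvPolynomial.coeff_map, div_eq_inv_mul]
    rfl
  · intro n hn
    have h0 : (cycle (n + 1)).fullW.coeff d ≠ 0 := by
      intro h
      simp [h] at hn
    have := degree_eq_of_coeff_cycle_ne_zero h0
    simp only [Finset.coe_range, Set.mem_Iio]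
    omega

/-- Each substituted series is divisible by `X`, since the empty tree has no root. -/
theorem coeff_prod_graft_eq_zero {N : ℕ} {d : Kind →₀ ℕ} (hd : N < d.degree) :
    PowerSeries.coeff N (d.prod fun s e => graft s ^ e) = 0 := by
  have h : (PowerSeries.X : PowerSeries ℚ[T;T⁻¹]) ^ d.degree ∣ d.prod fun s e => graft s ^ e := by
    rw [Finsupp.degree_apply, ← Finset.prod_pow_eq_pow_sum]
    refine Finset.prod_dvd_prod_of_dvd _ _ fun s _ => pow_dvd_pow_of_dvd ?_ _
    rw [PowerSeries.X_dvd_iff, ← PowerSeries.coeff_zero_eq_constantCoeff_apply, coeff_zero_graft]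
  exact PowerSeries.X_pow_dvd_iff.1 h N hd

theorem coeff_subst_cycleSeries (N : ℕ) :
    PowerSeries.coeff N (MvPowerSeries.subst graft cycleSeries) =
      PowerSeries.coeff N (MvPolynomial.aeval graft (truncCycle N)) := by
  rw [← MvPowerSeries.subst_coe]
  simp only [PowerSeries.coeff]
  rw [MvPowerSeries.coeff_subst hasSubst_graft, MvPowerSeries.coeff_subst hasSubst_graft]
  refine finsum_congr fun d => ?_
  rcases le_or_gt d.degree N with hd | hd
  · rw [coeff_cycleSeries hd, MvPolynomial.coeff_coe]
  · have := coeff_prod_graft_eq_zero hd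
    simp only [PowerSeries.coeff] at this
    rw [this, smul_zero, smul_zero]

theorem aeval_fullW {V H : Type*} [Fintype V] [DecidableEq V] [Fintype H] (G : Multigraph V H) :
    MvPolynomial.aeval graft (G.fullW.map (Int.castRingHom ℚ)) =
      ∑ c : V → ZMod 2, ∏ v, graft (G.kind c v) := by
  simp [fullW, map_sum, map_prod]

/-- Of 1/|Aut C_{n+1}| = 1/(2(n+1)), the factor 1/(n+1) forgets the base point and 1/2 remains. -/
theorem coeff_aeval_truncCycle (N : ℕ) :
    PowerSeries.coeff N (MvPolynomial.aeval graft (truncCycle N)) =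
      algebraMap ℚ ℚ[T;T⁻¹] (((2 * N.factorial : ℕ) : ℚ)⁻¹) * ∑ f : ConnFun (Fin N),
        ∑ c : Fin N → ZMod 2, LaurentPolynomial.T 1 ^ ((ofFun f.1).admissible c).card := by
  rw [← sum_pointedFun (V := Fin N) fun f => ∑ c : Fin N → ZMod 2,
    (LaurentPolynomial.T 1 : ℚ[T;T⁻¹]) ^ ((ofFun f).admissible c).card, Fintype.card_fin,
    truncCycle, map_sum, map_sum, Finset.mul_sum]
  refine Finset.sum_congr rfl fun n _ => ?_
  rw [map_mul, MvPolynomial.aeval_C, aeval_fullW, ← Algebra.smul_def, autCard_cycle,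
    PowerSeries.coeff_smul, map_sum, sum_coeff_prod_graft, Algebra.smul_def, ← mul_assoc,
    ← mul_assoc, ← map_mul, ← map_mul]
  congr 2
  simp only [Nat.cast_mul, mul_inv]
  ring

theorem coeff_toLaurentSeries_loopSeries (N : ℕ) :
    PowerSeries.coeff N (toLaurentSeries (loopSeries 1)) =
      algebraMap ℚ ℚ[T;T⁻¹] (((2 * N.factorial : ℕ) : ℚ)⁻¹) * ∑ f : ConnFun (Fin N),
        ∑ c : Fin N → ZMod 2, LaurentPolynomial.T 1 ^ ((ofFun f.1).admissible c).card := by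
  rw [toLaurentSeries, PowerSeries.coeff_map, (loopClass_sum N).2]
  simp only [W_eq_sum_pow, map_mul, map_sum, Polynomial.map_sum, Polynomial.map_pow,
    Polynomial.map_X, Polynomial.toLaurent_X, map_pow, Polynomial.toLaurent_C]
  rfl

end BlackWhite

/-- Cutting the cycle of a connected graph of loop number one leaves a cyclic sequence of rooted
trees, and the numbers of black neighbours on the cycle and in the trees add up. -/
theorem theorem4p4 :
    (∀ n : ℕ, Finite (BlackWhite.LoopClass 1 n)) ∧
    (∀ n : ℕ, Finite (BlackWhite.RootedTreeClass n)) ∧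
    (∀ d : BlackWhite.Kind →₀ ℕ,
      {n : ℕ | (BlackWhite.Multigraph.cycle (n + 1)).fullW.coeff d ≠ 0}.Finite) ∧
    MvPowerSeries.HasSubst BlackWhite.graft ∧
    MvPowerSeries.subst BlackWhite.graft BlackWhite.cycleSeries =
      BlackWhite.toLaurentSeries (BlackWhite.loopSeries 1) := by
  refine ⟨fun n => (BlackWhite.loopClass_sum n).1, fun n => (BlackWhite.treeClass_sum n .b).1,
    fun d => ?_, BlackWhite.hasSubst_graft, ?_⟩
  -- The index `n` stands for C_{n+1}, whose polynomial is homogeneous of degree n + 1.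
  · refine Set.Finite.subset (Set.finite_singleton (d.degree - 1)) fun n hn => ?_
    have := BlackWhite.degree_eq_of_coeff_cycle_ne_zero hn
    rw [Set.mem_singleton_iff]
    omega
  · refine PowerSeries.ext fun N => ?_
    rw [BlackWhite.coeff_subst_cycleSeries, BlackWhite.coeff_aeval_truncCycle,
      BlackWhite.coeff_toLaurentSeries_loopSeries]
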